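/- Let $M$ be a connected Hausdorff smooth ($C^\infty$) manifold of dimension $n+1\ge 2$, with a smooth Lorentz metric $g$ of signature $(-,+,\dots,+)$ and a time orientation given by a continuous timelike vector field. Write $I^\pm(p)$ and $J^\pm(p)$ for the chronological and causal future and past of $p$, defined by future-directed piecewise $C^1$ timelike and non-spacelike curves (with $p\in J^\pm(p)$), and $J^\pm(M)$ for the causal future and past of the set $M$. A (future-directed) *non-spacelike curve* is a continuous curve $\gamma$ on an interval of more than one point such that, for every parameter $t$ and every open $U\ni\gamma(t)$, one has $\gamma(s_1)\neq\gamma(s_2)$ and $\gamma(s_2)\in J^+(\gamma(s_1),U)$ for all $s_1<s_2$ in the interval that are close enough to $t$; it is *inextendible* if it has neither a future nor a past endpoint in $M$. *Strong causality* holds at $p$ if every neighbourhood of $p$ contains a neighbourhood of $p$ which no non-spacelike curve intersects more than once (that is, the curve meets it in a connected set of parameters). $(M,g)$ is *globally hyperbolic* if strong causality holds at every point and $J^+(p)\cap J^-(q)$ is compact for all $p,q\in M$. Let $C(p,q)$ be the set of non-spacelike curves from $p$ to $q$ up to reparametrization, with the topology whose basic open sets consist of all the curves with image contained in $W$, for $W\subseteq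 M$ open. A *Cauchy surface* is a closed acausal set (no two distinct points of it are joined by a non-spacelike curve) which is an embedded locally Lipschitz hypersurface and which each inextendible non-spacelike curve intersects exactly once. A *normalized volume measure* is a Borel measure $\mu$ with $\mu(M)=1$ which has, in each smooth chart, the same null sets as Lebesgue measure; put $f^\pm(p)=\mu(I^\pm(p))$ and $f=f^- /f^+$. **Theorem.** Let $(M,g)$ be globally hyperbolic. Then: 1. $J^+(p)$ and $J^-(p)$ are closed for all $p\in M$. 2. Strong causality holds on $M$, $M=J^-(M)\cap J^+(M)$, and the space $C(p,q)$ is compact for all $p,q\in M$. 3. There exist Cauchy surfaces. They are obtained as level sets of a volume-ratio time function: normalized volume measures exist, and for every such measure $\mu$ the functions $f^\pm$ are positive and continuous, $f$ is continuous and strictly increasing along every future-directed non-spacelike curve, and for every real $c>0$ the level set $\{p\in M: f(p)=c\}$ is a Cauchy surface. -/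

import Mathlib

open Set Topology MeasureTheory
open scoped Manifold ContDiff

noncomputable section

namespace Causality

/-- A space-time of dimension `n + 1` on the smooth manifold `M`: a smooth symmetric bilinear form
on the tangent spaces that has the diagonal form `(-,+,…,+)` at each point, and a time orientation,
given by a continuous timelike vector field. -/
structure Spacetime (n : ℕ) (M : Type*) [TopologicalSpace M]
    [ChartedSpace (EuclideanSpace ℝ (Fin (n + 1))) M] [IsManifold (𝓡 (n + 1)) ∞ M] where
  /-- The metric. -/
  metric (x : M) : TangentSpace (𝓡 (n + 1)) x →L[ℝ] TangentSpace (𝓡 (n + 1)) x →L[ℝ] ℝ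
  symm (x : M) (v w : TangentSpace (𝓡 (n + 1)) x) : metric x v w = metric x w v
  signature (x : M) : ∃ b : Module.Basis (Fin (n + 1)) ℝ (TangentSpace (𝓡 (n + 1)) x),
    ∀ i j, metric x (b i) (b j) = if i = j then (if i = 0 then -1 else 1) else 0
  contMDiff_metric : ContMDiff (𝓡 (n + 1))
    ((𝓡 (n + 1)).prod 𝓘(ℝ, EuclideanSpace ℝ (Fin (n + 1)) →L[ℝ]
      EuclideanSpace ℝ (Fin (n + 1)) →L[ℝ] ℝ)) ∞
    (fun x ↦ Bundle.TotalSpace.mk' (EuclideanSpace ℝ (Fin (n + 1)) →L[ℝ]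
      EuclideanSpace ℝ (Fin (n + 1)) →L[ℝ] ℝ) x (metric x))
  /-- The time orientation. -/
  orient (x : M) : TangentSpace (𝓡 (n + 1)) x
  continuous_orient :
    Continuous (fun x ↦ (⟨x, orient x⟩ : TangentBundle (𝓡 (n + 1)) M))
  timelike_orient (x : M) : metric x (orient x) (orient x) < 0

variable {n : ℕ} {M : Type*} [TopologicalSpace M]
  [ChartedSpace (EuclideanSpace ℝ (Fin (n + 1))) M] [IsManifold (𝓡 (n + 1)) ∞ M]

namespace Spacetime

variable (g : Spacetime n M)

/-- `v` is timelike and future-directed. -/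
def FutureTimelike (x : M) (v : TangentSpace (𝓡 (n + 1)) x) : Prop :=
  g.metric x v v < 0 ∧ g.metric x (g.orient x) v < 0

/-- `v` is timelike or null, and future-directed (in particular `v ≠ 0`). -/
def FutureCausal (x : M) (v : TangentSpace (𝓡 (n + 1)) x) : Prop :=
  g.metric x v v ≤ 0 ∧ g.metric x (g.orient x) v < 0

/-- There is a future-directed timelike curve of class `C¹` in `U` from `p` to `q`. -/
def TimelikeSegment (U : Set M) (p q : M) : Prop :=
  ∃ γ : ℝ → M, ContMDiffOn 𝓘(ℝ, ℝ) (𝓡 (n + 1)) 1 γ (Icc 0 1) ∧ γ 0 = p ∧ γ 1 = q ∧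
    ∀ t ∈ Icc (0 : ℝ) 1, γ t ∈ U ∧
      g.FutureTimelike (γ t) (mfderivWithin 𝓘(ℝ, ℝ) (𝓡 (n + 1)) γ (Icc 0 1) t (1 : ℝ))

/-- There is a future-directed non-spacelike curve of class `C¹` in `U` from `p` to `q`. -/
def CausalSegment (U : Set M) (p q : M) : Prop :=
  ∃ γ : ℝ → M, ContMDiffOn 𝓘(ℝ, ℝ) (𝓡 (n + 1)) 1 γ (Icc 0 1) ∧ γ 0 = p ∧ γ 1 = q ∧
    ∀ t ∈ Icc (0 : ℝ) 1, γ t ∈ U ∧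
      g.FutureCausal (γ t) (mfderivWithin 𝓘(ℝ, ℝ) (𝓡 (n + 1)) γ (Icc 0 1) t (1 : ℝ))

/-- The chronological future `I⁺(L, U)`: the points that are reached from `L` by a future-directed
timelike curve in `U`, the curves being piecewise `C¹` (finite chains of `C¹` segments). -/
def chronFuture (L U : Set M) : Set M :=
  {q | ∃ p ∈ L, Relation.TransGen (g.TimelikeSegment U) p q}

/-- The chronological past `I⁻(L, U)`. -/
def chronPast (L U : Set M) : Set M :=
  {q | ∃ p ∈ L, Relation.TransGen (g.TimelikeSegment U) q p}

/-- The causal future `J⁺(L, U)`: the union of `L ∩ U` with the set of the points that are reached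
from `L` by a future-directed non-spacelike (piecewise `C¹`) curve in `U`. -/
def causalFuture (L U : Set M) : Set M :=
  (L ∩ U) ∪ {q | ∃ p ∈ L, Relation.TransGen (g.CausalSegment U) p q}

/-- The causal past `J⁻(L, U)`. -/
def causalPast (L U : Set M) : Set M :=
  (L ∩ U) ∪ {q | ∃ p ∈ L, Relation.TransGen (g.CausalSegment U) q p}

/-- `γ`, restricted to the interval `F` (with more than one point), is a future-directed
non-spacelike curve. As usual in causality theory, non-spacelike curves are continuous curves: near
each parameter `t`, and inside any neighbourhood `U` of `γ t`, later points of the curve are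
different from earlier ones and lie in their causal future relative to `U`. Piecewise `C¹` curves
with future-directed non-spacelike tangents are of this kind. -/
def IsCausalCurve (F : Set ℝ) (γ : ℝ → M) : Prop :=
  F.OrdConnected ∧ F.Nontrivial ∧ ContinuousOn γ F ∧
    ∀ t ∈ F, ∀ U : Set M, IsOpen U → γ t ∈ U → ∃ G ∈ 𝓝 t, ∀ s₁ ∈ G ∩ F, ∀ s₂ ∈ G ∩ F, s₁ < s₂ →
      γ s₁ ≠ γ s₂ ∧ γ s₂ ∈ g.causalFuture {γ s₁} U

/-- Strong causality at `p`: every neighbourhood of `p` contains a neighbourhood of `p` which no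
non-spacelike curve intersects more than once, that is, which meets each such curve in a connected
set of parameters. -/
def StronglyCausalAt (p : M) : Prop :=
  ∀ U ∈ 𝓝 p, ∃ V ∈ 𝓝 p, V ⊆ U ∧
    ∀ (F : Set ℝ) (γ : ℝ → M), g.IsCausalCurve F γ → {t ∈ F | γ t ∈ V}.OrdConnected

/-- Global hyperbolicity. -/
def IsGloballyHyperbolic : Prop :=
  (∀ p, g.StronglyCausalAt p) ∧
    ∀ p q, IsCompact (g.causalFuture {p} univ ∩ g.causalPast {q} univ)

/-- The future-directed non-spacelike curves from `p` to `q`, parametrized by `[0, 1]`. -/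
def CausalPath (p q : M) : Type _ :=
  {γ : Path p q // g.IsCausalCurve (Icc 0 1) γ.extend}

/-- Two curves are equivalent if one is a reparametrization of the other (an order isomorphism
of `[0, 1]` is the same as an increasing homeomorphism). -/
def reparam (p q : M) : Setoid (g.CausalPath p q) where
  r γ l := ∃ f : unitInterval ≃o unitInterval, ∀ u, γ.1 (f u) = l.1 u
  iseqv :=
    { refl := fun _ ↦ ⟨OrderIso.refl _, fun _ ↦ rfl⟩
      symm := by
        rintro γ l ⟨f, hf⟩
        exact ⟨f.symm, fun u ↦ by rw [← hf, f.apply_symm_apply]⟩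
      trans := by
        rintro γ l m ⟨f, hf⟩ ⟨k, hk⟩
        exact ⟨k.trans f, fun u ↦ by rw [← hk, ← hf]; rfl⟩ }

/-- The space `C(p, q)` of the non-spacelike curves from `p` to `q`, up to reparametrization. -/
def CurveSpace (p q : M) : Type _ := Quotient (g.reparam p q)

/-- The set of the points of a curve in `C(p, q)`. -/
def CurveSpace.points {p q : M} (c : g.CurveSpace p q) : Set M :=
  Quotient.lift (s := g.reparam p q) (fun γ : g.CausalPath p q ↦ range γ.1) (by
    rintro γ l ⟨f, hf⟩
    have h : (l.1 : unitInterval → M) = γ.1 ∘ f := funext fun u ↦ (hf u).symm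
    change range (γ.1 : unitInterval → M) = range (l.1 : unitInterval → M)
    rw [h, f.surjective.range_comp]) c

/-- The topology of `C(p, q)`: the basic neighbourhoods of a curve consist of all the curves whose
points lie in a given open set `W` which contains the points of that curve. -/
instance (p q : M) : TopologicalSpace (g.CurveSpace p q) :=
  TopologicalSpace.generateFrom
    {A | ∃ W : Set M, IsOpen W ∧ A = {c | CurveSpace.points g c ⊆ W}}

/-- `p` is a future endpoint of the curve `γ` on `F`. -/
def IsFutureEndpoint (F : Set ℝ) (γ : ℝ → M) (p : M) : Prop :=
  ∀ V ∈ 𝓝 p, ∃ t ∈ F, ∀ t₁ ∈ F, t ≤ t₁ → γ t₁ ∈ V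

/-- `p` is a past endpoint of the curve `γ` on `F`. -/
def IsPastEndpoint (F : Set ℝ) (γ : ℝ → M) (p : M) : Prop :=
  ∀ V ∈ 𝓝 p, ∃ t ∈ F, ∀ t₁ ∈ F, t₁ ≤ t → γ t₁ ∈ V

/-- An inextendible non-spacelike curve: one with neither a future nor a past endpoint. -/
def IsInextendible (F : Set ℝ) (γ : ℝ → M) : Prop :=
  g.IsCausalCurve F γ ∧ (∀ p, ¬ IsFutureEndpoint F γ p) ∧ ∀ p, ¬ IsPastEndpoint F γ p

/-- `S` is an embedded locally Lipschitz hypersurface: near each of its points there are smooth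
coordinates `(x⁰, …, xⁿ)` in which `S` is the graph `x⁰ = h (x¹, …, xⁿ)` of a Lipschitz function. -/
def IsLipschitzHypersurface (n : ℕ) {M : Type*} [TopologicalSpace M]
    [ChartedSpace (EuclideanSpace ℝ (Fin (n + 1))) M] [IsManifold (𝓡 (n + 1)) ∞ M]
    (S : Set M) : Prop :=
  ∀ p ∈ S, ∃ e ∈ IsManifold.maximalAtlas (𝓡 (n + 1)) ∞ M, p ∈ e.source ∧
    ∃ (K : NNReal) (h : (Fin n → ℝ) → ℝ), LipschitzWith K h ∧
      ∀ x ∈ e.source, x ∈ S ↔ e x 0 = h (fun i ↦ e x i.succ)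

/-- `S` is acausal: no two different points of `S` are joined by a non-spacelike curve. -/
def IsAcausal (S : Set M) : Prop :=
  ∀ p ∈ S, ∀ q ∈ S, q ∈ g.causalFuture {p} univ → q = p

/-- A Cauchy surface: a hypersurface which is spacelike (in the sense that applies to locally
Lipschitz hypersurfaces, namely closed and acausal) and which each inextendible non-spacelike
curve intersects exactly once. -/
def IsCauchySurface (S : Set M) : Prop :=
  IsClosed S ∧ IsLipschitzHypersurface n S ∧ g.IsAcausal S ∧
    ∀ (F : Set ℝ) (γ : ℝ → M), g.IsInextendible F γ → ∃! t, t ∈ F ∧ γ t ∈ S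

/-- `μ` is a measure on `M` with total volume `1` which has, in each smooth chart, the same null
sets as Lebesgue measure. -/
def IsNormalizedVolume (n : ℕ) {M : Type*} [TopologicalSpace M]
    [ChartedSpace (EuclideanSpace ℝ (Fin (n + 1))) M] [IsManifold (𝓡 (n + 1)) ∞ M]
    [MeasurableSpace M] (μ : Measure M) : Prop :=
  μ univ = 1 ∧ ∀ e ∈ IsManifold.maximalAtlas (𝓡 (n + 1)) ∞ M, ∀ A ⊆ e.source, MeasurableSet A →
    (μ A = 0 ↔ volume (e '' A) = 0)

/-- The volume `f⁺(p)` of `I⁺(p)`. -/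
def volFuture [MeasurableSpace M] (μ : Measure M) (p : M) : ℝ :=
  μ.real (g.chronFuture {p} univ)

/-- The volume `f⁻(p)` of `I⁻(p)`. -/
def volPast [MeasurableSpace M] (μ : Measure M) (p : M) : ℝ :=
  μ.real (g.chronPast {p} univ)

/-- The volume ratio `f = f⁻ / f⁺`. -/
def volRatio [MeasurableSpace M] (μ : Measure M) (p : M) : ℝ :=
  g.volPast μ p / g.volFuture μ p

end Spacetime

end Causality

end

/-!
In a chart, the timelike and the causal directions near a point lie in convex cones varying
continuously with the point. Hence `I⁺(p)` and `I⁻(p)` are open, and a causal step followed by a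
chronological one is again chronological. Global hyperbolicity makes `J⁺(p)` and `J⁻(p)` closed: a
limit point of `J⁺(p)` is a limit of points of some compact `J⁺(p) ∩ J⁻(q)`.

The set `J⁻(p) \ I⁻(p)` is achronal, so that in suitable coordinates the lines in a timelike
direction meet it at most once; by Fubini it is a null set. By dominated convergence `f⁻` is
continuous, and so is `f⁺` by reversing the time orientation. Moreover `f⁻` is strictly increasing
and `f⁺` strictly decreasing along causal curves, whence `f = f⁻ / f⁺` is a time function.

A causal curve from `p` to `q` can be parametrized by `f`. Along an ultrafilter the curves so
parametrized converge pointwise in the compact set `J⁺(p) ∩ J⁻(q)`; the limit is causal because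
causal precedence is a closed relation, and this yields the compactness of `C(p, q)`.

Finally, an inextendible causal curve leaves `J⁻(y)` for every `y`, since it cannot stay in the
compact set `J⁺(x) ∩ J⁻(y)`. So `f⁺` tends to `0` along it, and dually `f⁻` does in the past,
whence `f` takes each positive value exactly once. The level sets of `f` are Lipschitz graphs
because `f` increases strictly in all directions of a cone.
-/

noncomputable section

namespace Causality

open Filter

/-! ### Lorentzian linear algebra -/

lemma eq_zero_and_eq_zero_of_sum_mul_eq {ι : Type*} [Fintype ι] {s t : ℝ} {a b : ι → ℝ}
    (ha : ∑ i, a i ^ 2 < s ^ 2) (hb : ∑ i, b i ^ 2 ≤ t ^ 2) (hab : ∑ i, a i * b i = s * t) :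
    t = 0 ∧ b = 0 := by
  have cauchy_schwarz := Finset.sum_mul_sq_le_sq_mul_sq Finset.univ a b
  rw [hab, mul_pow] at cauchy_schwarz
  have ha₀ : 0 ≤ ∑ i, a i ^ 2 := Finset.sum_nonneg fun i _ ↦ sq_nonneg _
  have ht : t = 0 := by
    by_contra ht
    have : 0 < t ^ 2 := by positivity
    nlinarith
  have hb₀ : ∑ i, b i ^ 2 = 0 := le_antisymm (by simpa [ht] using hb) (by positivity)
  rw [Finset.sum_eq_zero_iff_of_nonneg fun i _ ↦ sq_nonneg _] at hb₀
  exact ⟨ht, funext fun i ↦ sq_eq_zero_iff.1 (hb₀ i (Finset.mem_univ i))⟩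

namespace Spacetime

variable {n : ℕ} {M : Type*} [TopologicalSpace M]
  [ChartedSpace (EuclideanSpace ℝ (Fin (n + 1))) M] [IsManifold (𝓡 (n + 1)) ∞ M]
  (g : Spacetime n M)

lemma exists_basis_metric_eq (x : M) :
    ∃ b : Module.Basis (Fin (n + 1)) ℝ (TangentSpace (𝓡 (n + 1)) x), ∀ v w,
      g.metric x v w = -(b.repr v 0 * b.repr w 0) +
        ∑ i : Fin n, b.repr v i.succ * b.repr w i.succ := by
  obtain ⟨b, hb⟩ := g.signature x
  refine ⟨b, fun v w ↦ ?_⟩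
  conv_lhs => rw [← b.sum_repr v, ← b.sum_repr w]
  simp only [map_sum, map_smul, sum_apply, smul_apply, hb, smul_eq_mul, mul_ite, mul_zero]
  rw [Fin.sum_univ_succ]
  simp [Fin.succ_ne_zero, mul_comm]

lemma eq_zero_of_metric_eq_zero {x : M} {o v : TangentSpace (𝓡 (n + 1)) x}
    (ho : g.metric x o o < 0) (hv : g.metric x v v ≤ 0) (hov : g.metric x o v = 0) : v = 0 := by
  obtain ⟨b, hb⟩ := g.exists_basis_metric_eq x
  simp only [hb, ← sq] at ho hv hov
  obtain ⟨hv_time, hv_space⟩ := eq_zero_and_eq_zero_of_sum_mul_eq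
    (s := b.repr o 0) (t := b.repr v 0) (a := fun i : Fin n ↦ b.repr o i.succ)
    (b := fun i : Fin n ↦ b.repr v i.succ) (by linarith) (by linarith) (by linarith)
  exact b.repr.map_eq_zero_iff.1 (Finsupp.ext (Fin.cases hv_time (congrFun hv_space)))

end Spacetime

/-! ### Tangent vectors and curves in coordinates -/

section Coordinates

variable {E : Type*} [NormedAddCommGroup E] [NormedSpace ℝ E]
  {M : Type*} [TopologicalSpace M] [ChartedSpace E M]

/-- The tangent vector with coordinates `v` at the point with coordinates `y`, in the chart `e`;
it is meaningful for `y ∈ e.target`. -/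
def coordVec (e : OpenPartialHomeomorph M E) (y : E) : E →L[ℝ] TangentSpace 𝓘(ℝ, E) (e.symm y) :=
  mfderiv 𝓘(ℝ, E) 𝓘(ℝ, E) e.symm y

/-- The coordinate expression, in the chart `e`, of a field of bilinear forms. -/
def coordBilin (m : ∀ x : M, TangentSpace 𝓘(ℝ, E) x →L[ℝ] TangentSpace 𝓘(ℝ, E) x →L[ℝ] ℝ)
    (e : OpenPartialHomeomorph M E) (y : E) : E →L[ℝ] E →L[ℝ] ℝ :=
  ContinuousLinearMap.bilinearComp (E := E) (F := E) (m (e.symm y) : E →L[ℝ] E →L[ℝ] ℝ)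
    (coordVec e y : E →L[ℝ] E) (coordVec e y : E →L[ℝ] E)

/-- The coordinate expression, in the chart `e`, of a field of linear forms. -/
def coordLin (l : ∀ x : M, TangentSpace 𝓘(ℝ, E) x →L[ℝ] ℝ)
    (e : OpenPartialHomeomorph M E) (y : E) : E →L[ℝ] ℝ :=
  (l (e.symm y)).comp (coordVec e y)

lemma coordBilin_apply (m : ∀ x : M, TangentSpace 𝓘(ℝ, E) x →L[ℝ] TangentSpace 𝓘(ℝ, E) x →L[ℝ] ℝ)
    (e : OpenPartialHomeomorph M E) (y v w : E) :
    coordBilin m e y v w = m (e.symm y) (coordVec e y v) (coordVec e y w) := rfl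

lemma coordLin_apply (l : ∀ x : M, TangentSpace 𝓘(ℝ, E) x →L[ℝ] ℝ)
    (e : OpenPartialHomeomorph M E) (y v : E) :
    coordLin l e y v = l (e.symm y) (coordVec e y v) := rfl

variable {e : OpenPartialHomeomorph M E}

lemma coordVec_bijective (he : e ∈ IsManifold.maximalAtlas 𝓘(ℝ, E) ∞ M) {y : E}
    (hy : y ∈ e.target) : Function.Bijective (coordVec e y) := by
  have he' : e ∈ IsManifold.maximalAtlas 𝓘(ℝ, E) 1 M :=
    IsManifold.maximalAtlas_subset_of_le (by simp) he
  have hdiff : e.MDifferentiable 𝓘(ℝ, E) 𝓘(ℝ, E) :=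
    ⟨fun x hx ↦ (mdifferentiableAt_of_mem_maximalAtlas he' hx).mdifferentiableWithinAt,
      fun x hx ↦ (mdifferentiableAt_symm_of_mem_maximalAtlas he' hx).mdifferentiableWithinAt⟩
  exact hdiff.symm.mfderiv_bijective hy

lemma mfderivWithin_symm_comp (he : e ∈ IsManifold.maximalAtlas 𝓘(ℝ, E) ∞ M) {c : ℝ → E}
    {s : Set ℝ} {t : ℝ} (hs : UniqueDiffWithinAt ℝ s t) (hc : DifferentiableWithinAt ℝ c s t)
    (ht : c t ∈ e.target) :
    mfderivWithin 𝓘(ℝ, ℝ) 𝓘(ℝ, E) (e.symm ∘ c) s t (1 : ℝ) =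
      coordVec e (c t) (derivWithin c s t) := by
  have he' : e ∈ IsManifold.maximalAtlas 𝓘(ℝ, E) 1 M :=
    IsManifold.maximalAtlas_subset_of_le (by simp) he
  rw [mfderiv_comp_mfderivWithin t (mdifferentiableAt_symm_of_mem_maximalAtlas he' ht)
    hc.mdifferentiableWithinAt hs.uniqueMDiffWithinAt, mfderivWithin_eq_fderivWithin]
  rfl

variable [IsManifold 𝓘(ℝ, E) ∞ M]

lemma contMDiffOn_coordVec (he : e ∈ IsManifold.maximalAtlas 𝓘(ℝ, E) ∞ M) (u : E) :
    ContMDiffOn 𝓘(ℝ, E) 𝓘(ℝ, E).tangent ∞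
      (fun y ↦ (⟨e.symm y, coordVec e y u⟩ : TangentBundle 𝓘(ℝ, E) M)) e.target := by
  have htangent := (contMDiffOn_symm_of_mem_maximalAtlas he).contMDiffOn_tangentMapWithin
    (m := ∞) (n := ∞) (by simp) e.open_target.uniqueMDiffOn
  have hu : ContMDiffOn 𝓘(ℝ, E) 𝓘(ℝ, E).tangent ∞
      (fun y ↦ (⟨y, u⟩ : TangentBundle 𝓘(ℝ, E) E)) e.target :=
    contMDiffOn_vectorSpace_iff_contDiffOn.2 contDiffOn_const
  refine (htangent.comp hu fun y hy ↦ hy).congr fun y hy ↦ ?_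
  simp only [Function.comp, tangentMapWithin]
  rw [mfderivWithin_of_isOpen e.open_target hy]
  rfl

variable [FiniteDimensional ℝ E]
  {m : ∀ x : M, TangentSpace 𝓘(ℝ, E) x →L[ℝ] TangentSpace 𝓘(ℝ, E) x →L[ℝ] ℝ}
  (hm : ContMDiff 𝓘(ℝ, E) (𝓘(ℝ, E).prod 𝓘(ℝ, E →L[ℝ] E →L[ℝ] ℝ)) ∞
    (fun x ↦ Bundle.TotalSpace.mk' (E →L[ℝ] E →L[ℝ] ℝ) x (m x)))
include hm

lemma contDiffOn_coordBilin (he : e ∈ IsManifold.maximalAtlas 𝓘(ℝ, E) ∞ M) :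
    ContDiffOn ℝ ∞ (coordBilin m e) e.target := by
  refine contDiffOn_clm_apply.2 fun u ↦ contDiffOn_clm_apply.2 fun w ↦ ?_
  have h := (hm.comp_contMDiffOn
    (contMDiffOn_symm_of_mem_maximalAtlas he)).clm_bundle_apply₂ (F₁ := E)
    (F₂ := E) (E₃ := Bundle.Trivial M ℝ) (F₃ := ℝ)
    (contMDiffOn_coordVec he u) (contMDiffOn_coordVec he w)
  exact fun y hy ↦ contMDiffWithinAt_iff_contDiffWithinAt.1
    (Bundle.contMDiffWithinAt_totalSpace.1 (h y hy)).2

lemma continuousOn_coordLin {o : ∀ x : M, TangentSpace 𝓘(ℝ, E) x}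
    (ho : Continuous (fun x ↦ (⟨x, o x⟩ : TangentBundle 𝓘(ℝ, E) M)))
    (he : e ∈ IsManifold.maximalAtlas 𝓘(ℝ, E) ∞ M) :
    ContinuousOn (coordLin (fun x ↦ m x (o x)) e) e.target := by
  refine continuousOn_clm_apply.2 fun w ↦ ?_
  have hsymm := contMDiffOn_symm_of_mem_maximalAtlas he
  have h : ContMDiffOn 𝓘(ℝ, E) (𝓘(ℝ, E).prod 𝓘(ℝ, ℝ)) 0 _ e.target :=
    ((hm.of_le zero_le).comp_contMDiffOn (hsymm.of_le zero_le)).clm_bundle_apply₂ (F₁ := E)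
      (F₂ := E) (E₃ := Bundle.Trivial M ℝ) (F₃ := ℝ)
      (contMDiffOn_zero_iff.2 (ho.comp_continuousOn hsymm.continuousOn))
      ((contMDiffOn_coordVec he w).of_le zero_le)
  exact fun y hy ↦ (Bundle.contMDiffWithinAt_totalSpace.1 (h y hy)).2.continuousWithinAt

end Coordinates

section Segments

open Bundle

variable {E : Type*} [NormedAddCommGroup E] [NormedSpace ℝ E]
  {M : Type*} [TopologicalSpace M] [ChartedSpace E M]

/-- There is a `C¹` curve in `U` from `p` to `q` whose velocities satisfy `P`. Timelike and causal
segments, for both time orientations, are the instances of this notion. -/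
def Segment (P : ∀ x : M, TangentSpace 𝓘(ℝ, E) x → Prop) (U : Set M) (p q : M) : Prop :=
  ∃ γ : ℝ → M, ContMDiffOn 𝓘(ℝ, ℝ) 𝓘(ℝ, E) 1 γ (Icc 0 1) ∧ γ 0 = p ∧ γ 1 = q ∧
    ∀ t ∈ Icc (0 : ℝ) 1, γ t ∈ U ∧
      P (γ t) (mfderivWithin 𝓘(ℝ, ℝ) 𝓘(ℝ, E) γ (Icc 0 1) t (1 : ℝ))

variable {P Q : ∀ x : M, TangentSpace 𝓘(ℝ, E) x → Prop} {U V : Set M} {p q : M} {γ : ℝ → M}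

lemma Segment.mono (h : Segment P U p q) (hP : ∀ x v, P x v → Q x v) (hU : U ⊆ V) :
    Segment Q V p q := by
  obtain ⟨γ, hγ, h0, h1, h⟩ := h
  exact ⟨γ, hγ, h0, h1, fun t ht ↦ ⟨hU (h t ht).1, hP _ _ (h t ht).2⟩⟩

lemma mfderivWithin_comp_affine (hγ : ContMDiffOn 𝓘(ℝ, ℝ) 𝓘(ℝ, E) 1 γ (Icc 0 1)) {a b t : ℝ}
    (hab : MapsTo (fun s ↦ a + b * s) (Icc 0 1) (Icc 0 1)) (ht : t ∈ Icc (0 : ℝ) 1) :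
    mfderivWithin 𝓘(ℝ, ℝ) 𝓘(ℝ, E) (γ ∘ fun s ↦ a + b * s) (Icc 0 1) t (1 : ℝ) =
      b • mfderivWithin 𝓘(ℝ, ℝ) 𝓘(ℝ, E) γ (Icc 0 1) (a + b * t) (1 : ℝ) := by
  have hderiv : HasDerivAt (fun s : ℝ ↦ a + b * s) b t := by
    simpa using ((hasDerivAt_id t).const_mul b).const_add a
  have hunique : UniqueDiffWithinAt ℝ (Icc (0 : ℝ) 1) t := uniqueDiffOn_Icc zero_lt_one t ht
  have haffine : mfderivWithin 𝓘(ℝ, ℝ) 𝓘(ℝ, ℝ) (fun s : ℝ ↦ a + b * s) (Icc 0 1) t (1 : ℝ) = b := by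
    rw [mfderivWithin_eq_fderivWithin]
    exact (fderivWithin_derivWithin (𝕜 := ℝ)).trans (hderiv.hasDerivWithinAt.derivWithin hunique)
  have hlinear := (mfderivWithin 𝓘(ℝ, ℝ) 𝓘(ℝ, E) γ (Icc 0 1) (a + b * t)).map_smul b (1 : ℝ)
  rw [mfderivWithin_comp t ((hγ _ (hab ht)).mdifferentiableWithinAt one_ne_zero)
    hderiv.differentiableAt.differentiableWithinAt.mdifferentiableWithinAt hab
    hunique.uniqueMDiffWithinAt]
  refine (congrArg (mfderivWithin 𝓘(ℝ, ℝ) 𝓘(ℝ, E) γ (Icc 0 1) (a + b * t)) haffine).trans ?_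
  rw [← hlinear]
  exact congrArg _ (mul_one b).symm

lemma segment_comp_affine (hγ : ContMDiffOn 𝓘(ℝ, ℝ) 𝓘(ℝ, E) 1 γ (Icc 0 1)) {a b : ℝ}
    (hab : MapsTo (fun s ↦ a + b * s) (Icc 0 1) (Icc 0 1))
    (hP : ∀ t ∈ Icc (0 : ℝ) 1, γ (a + b * t) ∈ U ∧ P (γ (a + b * t))
      (b • mfderivWithin 𝓘(ℝ, ℝ) 𝓘(ℝ, E) γ (Icc 0 1) (a + b * t) (1 : ℝ))) :
    Segment P U (γ a) (γ (a + b)) := by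
  refine ⟨γ ∘ fun s ↦ a + b * s, hγ.comp ?_ hab, by simp, by simp, fun t ht ↦ ⟨(hP t ht).1, ?_⟩⟩
  · exact ContDiffOn.contMDiffOn (by fun_prop)
  · rw [mfderivWithin_comp_affine hγ hab ht]
    exact (hP t ht).2

lemma Segment.reverse (h : Segment P U p q) : Segment (fun x v ↦ P x (-v)) U q p := by
  obtain ⟨γ, hγ, rfl, rfl, h⟩ := h
  have hmaps : MapsTo (fun s : ℝ ↦ 1 + -1 * s) (Icc 0 1) (Icc 0 1) := fun s hs ↦
    ⟨by linarith [hs.2], by linarith [hs.1]⟩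
  simpa using segment_comp_affine (P := fun x v ↦ P x (-v)) (U := U) hγ hmaps fun t ht ↦
    ⟨(h _ (hmaps ht)).1, by simpa using (h _ (hmaps ht)).2⟩

lemma segment_of_subinterval
    (hP : ∀ (x : M) (v : TangentSpace 𝓘(ℝ, E) x) (r : ℝ), 0 < r → P x v → P x (r • v))
    (hγ : ContMDiffOn 𝓘(ℝ, ℝ) 𝓘(ℝ, E) 1 γ (Icc 0 1))
    (h : ∀ t ∈ Icc (0 : ℝ) 1, P (γ t) (mfderivWithin 𝓘(ℝ, ℝ) 𝓘(ℝ, E) γ (Icc 0 1) t (1 : ℝ)))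
    {a b : ℝ} (ha : 0 ≤ a) (hab : a < b) (hb : b ≤ 1) (hU : MapsTo γ (Icc a b) U) :
    Segment P U (γ a) (γ b) := by
  have hmaps : MapsTo (fun s : ℝ ↦ a + (b - a) * s) (Icc 0 1) (Icc a b) := fun s hs ↦
    ⟨by nlinarith [hs.1], by nlinarith [hs.2]⟩
  have hmaps' := hmaps.mono_right (Icc_subset_Icc ha hb)
  have hsegment := segment_comp_affine (P := P) (U := U) hγ hmaps' fun t ht ↦
    ⟨hU (hmaps ht), hP _ _ _ (sub_pos.2 hab) (h _ (hmaps' ht))⟩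
  rwa [add_sub_cancel] at hsegment

variable {e : OpenPartialHomeomorph M E}

lemma segment_of_coord (he : e ∈ IsManifold.maximalAtlas 𝓘(ℝ, E) ∞ M) {c : ℝ → E}
    (hc : ContDiffOn ℝ 1 c (Icc 0 1))
    (h : ∀ t ∈ Icc (0 : ℝ) 1, c t ∈ e.target ∧ e.symm (c t) ∈ U ∧
      P (e.symm (c t)) (coordVec e (c t) (derivWithin c (Icc 0 1) t))) :
    Segment P U (e.symm (c 0)) (e.symm (c 1)) := by
  refine ⟨e.symm ∘ c, ?_, rfl, rfl, fun t ht ↦ ⟨(h t ht).2.1, ?_⟩⟩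
  · exact ((contMDiffOn_symm_of_mem_maximalAtlas he).of_le (by simp)).comp hc.contMDiffOn
      fun t ht ↦ (h t ht).1
  · rw [mfderivWithin_symm_comp he (uniqueDiffOn_Icc zero_lt_one t ht)
      ((hc t ht).differentiableWithinAt one_ne_zero) (h t ht).1]
    exact (h t ht).2.2

lemma contDiffOn_coord (he : e ∈ IsManifold.maximalAtlas 𝓘(ℝ, E) ∞ M) {s : Set ℝ}
    (hγ : ContMDiffOn 𝓘(ℝ, ℝ) 𝓘(ℝ, E) 1 γ s) (hs : MapsTo γ s e.source) :
    ContDiffOn ℝ 1 (e ∘ γ) s :=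
  contMDiffOn_iff_contDiffOn.1
    (((contMDiffOn_of_mem_maximalAtlas he).of_le (by simp)).comp hγ hs)

lemma coordVec_derivWithin_coord (he : e ∈ IsManifold.maximalAtlas 𝓘(ℝ, E) ∞ M) {s : Set ℝ}
    (hγ : ContMDiffOn 𝓘(ℝ, ℝ) 𝓘(ℝ, E) 1 γ s) (hs : MapsTo γ s e.source) {t : ℝ} (ht : t ∈ s)
    (hunique : UniqueDiffWithinAt ℝ s t) :
    (⟨e.symm (e (γ t)), coordVec e (e (γ t)) (derivWithin (e ∘ γ) s t)⟩ : TangentBundle 𝓘(ℝ, E) M) =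
      ⟨γ t, mfderivWithin 𝓘(ℝ, ℝ) 𝓘(ℝ, E) γ s t (1 : ℝ)⟩ := by
  have hpoint : e.symm (e (γ t)) = γ t := e.left_inv (hs ht)
  have hvelocity := mfderivWithin_symm_comp he hunique
    ((contDiffOn_coord he hγ hs t ht).differentiableWithinAt one_ne_zero) (e.map_source (hs ht))
  have hcongr : (mfderivWithin 𝓘(ℝ, ℝ) 𝓘(ℝ, E) (e.symm ∘ e ∘ γ) s t : ℝ →L[ℝ] E) =
      mfderivWithin 𝓘(ℝ, ℝ) 𝓘(ℝ, E) γ s t :=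
    mfderivWithin_congr (fun r hr ↦ e.left_inv (hs hr)) hpoint
  exact TotalSpace.ext hpoint (heq_of_eq
    (hvelocity.symm.trans (congrArg (fun f : ℝ →L[ℝ] E ↦ f 1) hcongr)))

lemma Segment.exists_coord (h : Segment P U p q)
    (he : e ∈ IsManifold.maximalAtlas 𝓘(ℝ, E) ∞ M) (hU : U ⊆ e.source) :
    ∃ c : ℝ → E, ContDiffOn ℝ 1 c (Icc 0 1) ∧ c 0 = e p ∧ c 1 = e q ∧
      ∀ t ∈ Icc (0 : ℝ) 1, c t ∈ e.target ∧ e.symm (c t) ∈ U ∧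
        P (e.symm (c t)) (coordVec e (c t) (derivWithin c (Icc 0 1) t)) := by
  obtain ⟨γ, hγ, rfl, rfl, h⟩ := h
  have hsource : MapsTo γ (Icc 0 1) e.source := fun t ht ↦ hU (h t ht).1
  refine ⟨e ∘ γ, contDiffOn_coord he hγ hsource, rfl, rfl, fun t ht ↦
    ⟨e.map_source (hsource ht), ?_, ?_⟩⟩
  · exact (e.left_inv (hsource ht)).symm ▸ (h t ht).1
  · exact (congrArg (fun z : TangentBundle 𝓘(ℝ, E) M ↦ P z.1 z.2) (coordVec_derivWithin_coord he hγ
      hsource ht (uniqueDiffOn_Icc zero_lt_one t ht))).mpr (h t ht).2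

end Segments

/-! ### Light cones in a vector space -/

section Cones

variable {E : Type*} [NormedAddCommGroup E] [NormedSpace ℝ E]
  {G : E → E →L[ℝ] E →L[ℝ] ℝ} {N : E → E →L[ℝ] ℝ} {Ω W : Set E} {y₀ u v : E}

lemma continuousAt_bilin_diag (hG : ContinuousAt G y₀) (v : E) :
    ContinuousAt (fun z : E × E ↦ G z.1 z.2 z.2) (y₀, v) :=
  ((ContinuousAt.comp (f := Prod.fst) (x := (y₀, v)) hG continuousAt_fst).clm_apply
    continuousAt_snd).clm_apply continuousAt_snd

lemma continuousAt_lin_apply (hN : ContinuousAt N y₀) (v : E) :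
    ContinuousAt (fun z : E × E ↦ N z.1 z.2) (y₀, v) :=
  (ContinuousAt.comp (f := Prod.fst) (x := (y₀, v)) hN continuousAt_fst).clm_apply continuousAt_snd

lemma eventually_timelike (hG : ContinuousAt G y₀) (hN : ContinuousAt N y₀)
    (hGu : G y₀ u u < 0) (hNu : N y₀ u < 0) :
    ∀ᶠ z : E × E in 𝓝 (y₀, u), G z.1 z.2 z.2 < 0 ∧ N z.1 z.2 < 0 :=
  ((continuousAt_bilin_diag hG u).eventually_lt_const hGu).and
    ((continuousAt_lin_apply hN u).eventually_lt_const hNu)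

lemma exists_forall_norm_eq_one_lt [FiniteDimensional ℝ E] {A : E →L[ℝ] E →L[ℝ] ℝ}
    {B : E →L[ℝ] ℝ} (h : ∀ v, A v v ≤ 0 → B v = 0 → v = 0) :
    ∃ k > 0, ∀ v, ‖v‖ = 1 → A v v ≤ 0 → B v ≤ 0 → k < -B v := by
  let S := Metric.sphere (0 : E) 1 ∩ {v | A v v ≤ 0 ∧ B v ≤ 0}
  have hmem : ∀ v, ‖v‖ = 1 → A v v ≤ 0 → B v ≤ 0 → v ∈ S := fun v hv hA hB ↦
    ⟨mem_sphere_zero_iff_norm.2 hv, hA, hB⟩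
  have hA : Continuous fun v ↦ A v v := by fun_prop
  have hcompact : IsCompact S := (isCompact_sphere _ _).inter_right <|
    (isClosed_le hA continuous_const).inter (isClosed_le B.continuous continuous_const)
  rcases S.eq_empty_or_nonempty with hempty | hne
  · exact ⟨1, one_pos, fun v hv hA hB ↦ by simpa [hempty] using hmem v hv hA hB⟩
  obtain ⟨w, ⟨hw, hAw, hBw⟩, hmin⟩ := hcompact.exists_isMinOn hne (f := fun v ↦ -B v) (by fun_prop)
  have hw0 : w ≠ 0 := by rintro rfl; simp at hw
  have hpos : 0 < -B w := neg_pos.2 (hBw.lt_of_ne fun hB ↦ hw0 (h w hAw hB))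
  exact ⟨-B w / 2, half_pos hpos, fun v hv hA hB ↦ (half_lt_self hpos).trans_le
    (hmin (hmem v hv hA hB))⟩

lemma eventually_causal_le [FiniteDimensional ℝ E] (hG : ContinuousAt G y₀)
    (hN : ContinuousAt N y₀) {k : ℝ}
    (hk : ∀ v, ‖v‖ = 1 → G y₀ v v ≤ 0 → N y₀ v ≤ 0 → k < -N y₀ v) :
    ∀ᶠ y in 𝓝 y₀, ∀ v, G y v v ≤ 0 → N y v ≤ 0 → k * ‖v‖ ≤ -N y₀ v := by
  have hsphere : ∀ᶠ y in 𝓝 y₀, ∀ v ∈ Metric.sphere (0 : E) 1,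
      0 < G y v v ∨ 0 < N y v ∨ k < -N y₀ v := by
    refine (isCompact_sphere (0 : E) 1).eventually_forall_of_forall_eventually fun v hv ↦ ?_
    by_cases hGv : 0 < G y₀ v v
    · exact ((continuousAt_bilin_diag hG v).eventually_const_lt hGv).mono fun _ ↦ Or.inl
    by_cases hNv : 0 < N y₀ v
    · exact ((continuousAt_lin_apply hN v).eventually_const_lt hNv).mono fun _ ↦ Or.inr ∘ Or.inl
    have hcont : ContinuousAt (fun z : E × E ↦ -N y₀ z.2) (y₀, v) := by fun_prop
    exact (hcont.eventually_const_lt (hk v (mem_sphere_zero_iff_norm.1 hv) (not_lt.1 hGv)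
      (not_lt.1 hNv))).mono fun _ ↦ Or.inr ∘ Or.inr
  refine hsphere.mono fun y hy v hGv hNv ↦ ?_
  rcases eq_or_ne v 0 with rfl | hv
  · simp
  have hinv : 0 < ‖v‖⁻¹ := inv_pos.2 (norm_pos_iff.2 hv)
  have hunit : ‖v‖⁻¹ • v ∈ Metric.sphere (0 : E) 1 := by
    simp [norm_smul, norm_ne_zero_iff.2 hv]
  have hGunit : ¬ 0 < G y (‖v‖⁻¹ • v) (‖v‖⁻¹ • v) := by
    simpa only [map_smul, smul_apply, smul_eq_mul, not_lt] using
      mul_nonpos_of_nonneg_of_nonpos hinv.le (mul_nonpos_of_nonneg_of_nonpos hinv.le hGv)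
  have hNunit : ¬ 0 < N y (‖v‖⁻¹ • v) := by
    simpa only [map_smul, smul_eq_mul, not_lt] using
      mul_nonpos_of_nonneg_of_nonpos hinv.le hNv
  have hlt := ((hy _ hunit).resolve_left hGunit).resolve_left hNunit
  rw [map_smul, smul_eq_mul, ← mul_neg, ← div_eq_inv_mul, lt_div_iff₀ (norm_pos_iff.2 hv)] at hlt
  exact hlt.le

lemma exists_causal_le [FiniteDimensional ℝ E] (hG : ContinuousAt G y₀) (hN : ContinuousAt N y₀)
    (h : ∀ v, G y₀ v v ≤ 0 → N y₀ v = 0 → v = 0) :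
    ∃ k > 0, ∀ᶠ y in 𝓝 y₀, ∀ v, G y v v ≤ 0 → N y v ≤ 0 → k * ‖v‖ ≤ -N y₀ v := by
  obtain ⟨k, hk, hlt⟩ := exists_forall_norm_eq_one_lt h
  exact ⟨k, hk, eventually_causal_le hG hN hlt⟩

lemma lt_of_forall_derivWithin_pos {c : ℝ → E} (hc : ContDiffOn ℝ 1 c (Icc 0 1)) (τ : E →L[ℝ] ℝ)
    (h : ∀ t ∈ Icc (0 : ℝ) 1, 0 < τ (derivWithin c (Icc 0 1) t)) : τ (c 0) < τ (c 1) := by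
  refine strictMonoOn_of_deriv_pos (f := τ ∘ c) (convex_Icc (0 : ℝ) 1)
    (τ.continuous.comp_continuousOn hc.continuousOn) (fun t ht ↦ ?_) (by simp) (by simp) one_pos
  rw [interior_Icc] at ht
  have hderiv : HasDerivAt c (derivWithin c (Icc 0 1) t) t :=
    (((hc t (Ioo_subset_Icc_self ht)).differentiableWithinAt
      one_ne_zero).hasDerivWithinAt).hasDerivAt (Icc_mem_nhds ht.1 ht.2)
  rw [(τ.hasFDerivAt.comp_hasDerivAt t hderiv).deriv]
  exact h t (Ioo_subset_Icc_self ht)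

lemma timelike_add_smul {A : E →L[ℝ] E →L[ℝ] ℝ} {B B₀ : E →L[ℝ] ℝ} {k β : ℝ}
    (hk : 0 < k) (hβ : 0 < β) (hsymm : ∀ v w, A v w = A w v)
    (hcone : ∀ w, A w w ≤ 0 → B w ≤ 0 → k * ‖w‖ ≤ -B₀ w) (hu : ‖A u - B₀‖ ≤ k / 2)
    (huu : A u u < 0) (hv : k * ‖v‖ ≤ -B₀ v) (hvv : A v v ≤ β * (k * ‖v‖)) :
    A (v + β • u) (v + β • u) < 0 ∧ B (v + β • u) < 0 := by
  have hdiff : ∀ w, |A u w - B₀ w| ≤ k / 2 * ‖w‖ := fun w ↦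
    ((A u - B₀).le_opNorm w).trans (by gcongr)
  have hAv : A u v ≤ -(k / 2 * ‖v‖) := by linarith [(abs_le.1 (hdiff v)).2]
  have hβuu : β * A u u < 0 := mul_neg_of_pos_of_neg hβ huu
  have hneg : A (v + β • u) (v + β • u) < 0 := by
    have hexpand : A (v + β • u) (v + β • u) = A v v + 2 * (β * A u v) + β * (β * A u u) := by
      simp only [map_add, map_smul, add_apply, smul_apply, smul_eq_mul, hsymm v u]
      ring
    rw [hexpand]
    linarith [mul_le_mul_of_nonneg_left hAv hβ.le, mul_neg_of_pos_of_neg hβ hβuu]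
  refine ⟨hneg, ?_⟩
  by_contra! hB
  have hopposite := hcone (-(v + β • u)) (by simpa only [map_neg, neg_apply, neg_neg] using hneg.le)
    (by simpa only [map_neg, neg_nonpos] using hB)
  rw [norm_neg, map_neg, neg_neg] at hopposite
  have hAu : A u (v + β • u) = A u v + β * A u u := by rw [map_add, map_smul, smul_eq_mul]
  linarith [(abs_le.1 (hdiff (v + β • u))).1, mul_nonneg hk.le (norm_nonneg (v + β • u)),
    mul_nonneg hk.le (norm_nonneg v)]

/-- The bounds on the causal cones of `(G, N)` that hold, uniformly in the base point, on a small
set `W`: the cones lie in a fixed round cone, `u` is timelike and almost dual to `B`, and the metric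
is Lipschitz. -/
structure HasUniformCones (G : E → E →L[ℝ] E →L[ℝ] ℝ) (N : E → E →L[ℝ] ℝ) (B : E →L[ℝ] ℝ) (u : E)
    (k : ℝ) (C : NNReal) (W : Set E) : Prop where
  pos : 0 < k
  causal_le : ∀ y ∈ W, ∀ v, G y v v ≤ 0 → N y v ≤ 0 → k * ‖v‖ ≤ -B v
  norm_sub_le : ∀ y ∈ W, ‖G y u - B‖ ≤ k / 2
  timelike : ∀ y ∈ W, G y u u < 0
  lipschitz : LipschitzOnWith C G W

lemma exists_hasUniformCones [FiniteDimensional ℝ E] (hΩ : Ω ∈ 𝓝 y₀) (hG : ContDiffAt ℝ 1 G y₀)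
    (hN : ContinuousAt N y₀) (h : ∀ v, G y₀ v v ≤ 0 → N y₀ v = 0 → v = 0) (hu : N y₀ = G y₀ u)
    (huu : G y₀ u u < 0) :
    ∃ k C W, IsOpen W ∧ y₀ ∈ W ∧ W ⊆ Ω ∧ HasUniformCones G N (N y₀) u k C W := by
  obtain ⟨k, hk, hcone⟩ := exists_causal_le hG.continuousAt hN h
  obtain ⟨C, T, hT, hLip⟩ := hG.exists_lipschitzOnWith
  have hGu : ContinuousAt (fun y ↦ G y u) y₀ := hG.continuousAt.clm_apply continuousAt_const
  have hnorm : ∀ᶠ y in 𝓝 y₀, ‖G y u - N y₀‖ < k / 2 :=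
    (hGu.sub continuousAt_const).norm.eventually_lt_const (by simpa [hu] using hk)
  have htimelike : ∀ᶠ y in 𝓝 y₀, G y u u < 0 :=
    (hGu.clm_apply continuousAt_const).eventually_lt_const huu
  obtain ⟨W, hW, hWopen, hy₀⟩ := eventually_nhds_iff.1
    (hcone.and (hnorm.and (htimelike.and (inter_mem hΩ hT))))
  exact ⟨k, C, W, hWopen, hy₀, fun y hy ↦ (hW y hy).2.2.2.1, hk, fun y hy ↦ (hW y hy).1,
    fun y hy ↦ (hW y hy).2.1.le, fun y hy ↦ (hW y hy).2.2.1,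
    hLip.mono fun y hy ↦ (hW y hy).2.2.2.2⟩

lemma HasUniformCones.timelike_add_smul {B : E →L[ℝ] ℝ} {k : ℝ} {C : NNReal}
    (hW : HasUniformCones G N B u k C W) (hsymm : ∀ y v w, G y v w = G y w v) {y : E} {s β : ℝ}
    (hy : y ∈ W) (hz : y + s • u ∈ W) (hs : 0 ≤ s) (hβ : 0 < β) (hGv : G y v v ≤ 0)
    (hNv : N y v ≤ 0) (hsβ : C * ‖u‖ * ‖v‖ * s ≤ β * k) :
    G (y + s • u) (v + β • u) (v + β • u) < 0 ∧ N (y + s • u) (v + β • u) < 0 := by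
  refine Causality.timelike_add_smul hW.pos hβ (hsymm _) (hW.causal_le _ hz) (hW.norm_sub_le _ hz)
    (hW.timelike _ hz) (hW.causal_le y hy v hGv hNv) ?_
  have hLip : ‖G (y + s • u) - G y‖ ≤ C * (s * ‖u‖) :=
    hW.lipschitz.norm_sub_le_of_le hz hy
      (by rw [add_sub_cancel_left, norm_smul, Real.norm_of_nonneg hs])
  calc G (y + s • u) v v = (G (y + s • u) - G y) v v + G y v v := by simp
    _ ≤ ‖G (y + s • u) - G y‖ * ‖v‖ * ‖v‖ + 0 :=
      add_le_add ((le_abs_self _).trans ((G (y + s • u) - G y).le_opNorm₂ v v)) hGv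
    _ ≤ C * (s * ‖u‖) * ‖v‖ * ‖v‖ := by rw [add_zero]; gcongr
    _ = C * ‖u‖ * ‖v‖ * s * ‖v‖ := by ring
    _ ≤ β * k * ‖v‖ := by gcongr
    _ = β * (k * ‖v‖) := by ring

lemma eventually_forall_add_smul_mem {T : Type*} [TopologicalSpace T] {K : Set T}
    (hK : IsCompact K) {c w : T → E} (hc : ContinuousOn c K) (hw : ContinuousOn w K)
    (hW : IsOpen W) (h : MapsTo c K W) : ∀ᶠ ε in 𝓝 (0 : ℝ), ∀ t ∈ K, c t + ε • w t ∈ W := by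
  have := isCompact_iff_compactSpace.1 hK
  have hcont : Continuous fun z : ℝ × K ↦ c z.2 + z.1 • w z.2 :=
    (hc.domRestrict.comp continuous_snd).add
      (continuous_fst.smul (hw.domRestrict.comp continuous_snd))
  have hmem : ∀ᶠ ε in 𝓝 (0 : ℝ), ∀ t ∈ (univ : Set K), c t + ε • w t ∈ W :=
    isCompact_univ.eventually_forall_of_forall_eventually fun t _ ↦
      hcont.continuousAt.eventually_mem (hW.mem_nhds (by simpa using h t.2))
  exact hmem.mono fun ε hε t ht ↦ hε ⟨t, ht⟩ (mem_univ _)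

lemma hasDerivWithinAt_add_exp_smul {c : ℝ → E} {v : E} {s : Set ℝ} {t : ℝ}
    (hc : HasDerivWithinAt c v s t) (ε l : ℝ) (u : E) :
    HasDerivWithinAt (fun t ↦ c t + ε • (Real.exp (l * t) - 1) • u)
      (v + (ε * (Real.exp (l * t) * l)) • u) s t := by
  have hexp : HasDerivAt (fun t : ℝ ↦ Real.exp (l * t)) (Real.exp (l * t) * l) t := by
    simpa using ((hasDerivAt_id t).const_mul l).exp
  have hdisplacement := ((hexp.sub_const 1).smul_const u).const_smul ε
  rw [← mul_smul] at hdisplacement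
  exact hc.add hdisplacement.hasDerivWithinAt

lemma HasUniformCones.exists_timelike_deformation {B : E →L[ℝ] ℝ} {k : ℝ} {C : NNReal}
    (hW : HasUniformCones G N B u k C W) (hWopen : IsOpen W) (hsymm : ∀ y v w, G y v w = G y w v)
    {c : ℝ → E} (hc : ContDiffOn ℝ 1 c (Icc 0 1))
    (hcausal : ∀ t ∈ Icc (0 : ℝ) 1, c t ∈ W ∧
      G (c t) (derivWithin c (Icc 0 1) t) (derivWithin c (Icc 0 1) t) ≤ 0 ∧
      N (c t) (derivWithin c (Icc 0 1) t) ≤ 0) :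
    ∃ a : ℝ, ∀ᶠ ε in 𝓝[>] (0 : ℝ), ∃ d : ℝ → E, ContDiffOn ℝ 1 d (Icc 0 1) ∧ d 0 = c 0 ∧
      d 1 = c 1 + (ε * a) • u ∧ ∀ t ∈ Icc (0 : ℝ) 1, d t ∈ W ∧
        G (d t) (derivWithin d (Icc 0 1) t) (derivWithin d (Icc 0 1) t) < 0 ∧
        N (d t) (derivWithin d (Icc 0 1) t) < 0 := by
  obtain ⟨b, hb⟩ : ∃ b, ∀ t ∈ Icc (0 : ℝ) 1, ‖derivWithin c (Icc 0 1) t‖ ≤ b :=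
    isCompact_Icc.exists_bound_of_continuousOn
      (hc.continuousOn_derivWithin (uniqueDiffOn_Icc one_pos) le_rfl)
  have hb₀ : 0 ≤ b := (norm_nonneg _).trans (hb 0 (by simp))
  have hk := hW.pos
  -- `l` is so large that the growth `ε l exp (l t)` of the displacement in the timelike direction
  -- `u` outweighs the change of the metric, which is proportional to the displacement.
  obtain ⟨l, hl, hbl⟩ : ∃ l > 0, C * ‖u‖ * b ≤ l * k :=
    ⟨C * ‖u‖ * b / k + 1, by positivity, by rw [add_mul, div_mul_cancel₀ _ hk.ne']; linarith⟩
  refine ⟨Real.exp l - 1, ?_⟩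
  filter_upwards [nhdsWithin_le_nhds (eventually_forall_add_smul_mem isCompact_Icc hc.continuousOn
    (w := fun t ↦ (Real.exp (l * t) - 1) • u) (by fun_prop) hWopen fun t ht ↦ (hcausal t ht).1),
    self_mem_nhdsWithin] with ε hmem (hε : 0 < ε)
  refine ⟨fun t ↦ c t + ε • (Real.exp (l * t) - 1) • u, hc.add (ContDiff.contDiffOn (by fun_prop)),
    by simp, by simp [mul_smul], fun t ht ↦ ⟨hmem t ht, ?_⟩⟩
  rw [(hasDerivWithinAt_add_exp_smul ((hc t ht).differentiableWithinAt
    one_ne_zero).hasDerivWithinAt ε l u).derivWithin (uniqueDiffOn_Icc one_pos t ht)]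
  have hexp : 1 ≤ Real.exp (l * t) := Real.one_le_exp (mul_nonneg hl.le ht.1)
  obtain ⟨hcW, hGv, hNv⟩ := hcausal t ht
  have hdisp : 0 ≤ ε * (Real.exp (l * t) - 1) := mul_nonneg hε.le (sub_nonneg.2 hexp)
  simp only [← mul_smul]
  refine hW.timelike_add_smul hsymm hcW (by simpa only [← mul_smul] using hmem t ht) hdisp
    (by positivity) hGv hNv ?_
  calc C * ‖u‖ * ‖derivWithin c (Icc 0 1) t‖ * (ε * (Real.exp (l * t) - 1))
      ≤ C * ‖u‖ * b * (ε * (Real.exp (l * t) - 1)) := by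
        gcongr
        exact hb t ht
    _ ≤ l * k * (ε * (Real.exp (l * t) - 1)) := by gcongr
    _ ≤ l * k * (ε * Real.exp (l * t)) := by gcongr; exact sub_le_self _ zero_le_one
    _ = ε * (Real.exp (l * t) * l) * k := by ring

end Cones

/-! ### Local causality -/

lemma target_inter_preimage_symm_mem_nhds {X Y : Type*} [TopologicalSpace X] [TopologicalSpace Y]
    {e : OpenPartialHomeomorph X Y} {x : X} {U : Set X} (hx : x ∈ e.source) (hU : U ∈ 𝓝 x) :
    e.target ∩ e.symm ⁻¹' U ∈ 𝓝 (e x) :=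
  inter_mem (e.open_target.mem_nhds (e.map_source hx))
    ((e.continuousAt_symm (e.map_source hx)).preimage_mem_nhds (by rwa [e.left_inv hx]))

lemma exists_chord_mem_nhds {F : Type*} [NormedAddCommGroup F] [NormedSpace ℝ F] {c : ℝ → F}
    {v : F} (hc : HasDerivWithinAt c v (Icc 0 1) 1) {A B : Set F}
    (hA : A ∈ 𝓝 (c 1)) (hB : B ∈ 𝓝 v) :
    ∃ t ∈ Ioo (0 : ℝ) 1, c t ∈ A ∧ ∀ᶠ y in 𝓝 (c 1), (1 - t)⁻¹ • (y - c t) ∈ B := by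
  have hIoo := hc.mono Ioo_subset_Icc_self
  have hslope := (hasDerivWithinAt_iff_tendsto_slope' (by simp)).1 hIoo
  have : (𝓝[Ioo (0 : ℝ) 1] 1).NeBot := by rw [nhdsWithin_Ioo_eq_nhdsLT one_pos]; infer_instance
  obtain ⟨t, ht, htA, htB⟩ := (eventually_mem_nhdsWithin.and
    ((hIoo.continuousWithinAt.eventually_mem hA).and
      (hslope.eventually (eventually_mem_nhds_iff.2 hB)))).exists
  refine ⟨t, ht, htA, ContinuousAt.eventually_mem (by fun_prop) ?_⟩
  rwa [slope_comm, slope_def_module] at htB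

section LocalCausality

variable {E : Type*} [NormedAddCommGroup E] [NormedSpace ℝ E]
  {M : Type*} [TopologicalSpace M] [ChartedSpace E M]

/-- The future-directed timelike vectors of a metric `m` with time orientation `o`. Unlike
`Spacetime.FutureTimelike`, it makes sense over any model space. -/
def TimelikeVec (m : ∀ x : M, TangentSpace 𝓘(ℝ, E) x →L[ℝ] TangentSpace 𝓘(ℝ, E) x →L[ℝ] ℝ)
    (o : ∀ x : M, TangentSpace 𝓘(ℝ, E) x) (x : M) (v : TangentSpace 𝓘(ℝ, E) x) : Prop :=
  m x v v < 0 ∧ m x (o x) v < 0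

/-- The future-directed causal vectors of a metric `m` with time orientation `o`. -/
def CausalVec (m : ∀ x : M, TangentSpace 𝓘(ℝ, E) x →L[ℝ] TangentSpace 𝓘(ℝ, E) x →L[ℝ] ℝ)
    (o : ∀ x : M, TangentSpace 𝓘(ℝ, E) x) (x : M) (v : TangentSpace 𝓘(ℝ, E) x) : Prop :=
  m x v v ≤ 0 ∧ m x (o x) v < 0

variable {m : ∀ x : M, TangentSpace 𝓘(ℝ, E) x →L[ℝ] TangentSpace 𝓘(ℝ, E) x →L[ℝ] ℝ}
  {o : ∀ x : M, TangentSpace 𝓘(ℝ, E) x} {e : OpenPartialHomeomorph M E} {U : Set M} {p q : M}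

lemma TimelikeVec.smul {x : M} {v : TangentSpace 𝓘(ℝ, E) x} (h : TimelikeVec m o x v) {r : ℝ}
    (hr : 0 < r) : TimelikeVec m o x (r • v) := by
  simp only [TimelikeVec, map_smul, smul_apply, smul_eq_mul]
  exact ⟨mul_neg_of_pos_of_neg hr (mul_neg_of_pos_of_neg hr h.1), mul_neg_of_pos_of_neg hr h.2⟩

lemma CausalVec.smul {x : M} {v : TangentSpace 𝓘(ℝ, E) x} (h : CausalVec m o x v) {r : ℝ}
    (hr : 0 < r) : CausalVec m o x (r • v) := by
  simp only [CausalVec, map_smul, smul_apply, smul_eq_mul]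
  exact ⟨mul_nonpos_of_nonneg_of_nonpos hr.le (mul_nonpos_of_nonneg_of_nonpos hr.le h.1),
    mul_neg_of_pos_of_neg hr h.2⟩

lemma segment_timelikeVec_add (he : e ∈ IsManifold.maximalAtlas 𝓘(ℝ, E) ∞ M) {B : Set E} {x w : E}
    (hB : Convex ℝ B) (hBe : B ⊆ e.target) (hx : x ∈ B) (hxw : x + w ∈ B)
    (hw : ∀ y ∈ B, coordBilin m e y w w < 0 ∧ coordLin (fun x ↦ m x (o x)) e y w < 0) :
    Segment (TimelikeVec m o) univ (e.symm x) (e.symm (x + w)) := by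
  have hline := segment_of_coord (P := TimelikeVec m o) (U := univ) (c := fun t ↦ x + t • w) he
    (ContDiff.contDiffOn (by fun_prop)) fun t ht ↦ by
      have hmem : x + t • w ∈ B := hB.add_smul_mem hx hxw ht
      have hderiv : derivWithin (fun t : ℝ ↦ x + t • w) (Icc 0 1) t = w := by
        have hline : HasDerivAt (fun t : ℝ ↦ x + t • w) ((1 : ℝ) • w) t :=
          ((hasDerivAt_id t).smul_const w).const_add x
        rw [hline.hasDerivWithinAt.derivWithin (uniqueDiffOn_Icc one_pos t ht), one_smul]
      rw [hderiv]
      exact ⟨hBe hmem, mem_univ _, hw _ hmem⟩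
  simpa using hline

lemma segment_timelikeVec_add_smul (he : e ∈ IsManifold.maximalAtlas 𝓘(ℝ, E) ∞ M) {B : Set E}
    {x w : E} {s : ℝ} (hs : 0 < s) (hB : Convex ℝ B) (hBe : B ⊆ e.target) (hx : x ∈ B)
    (hxw : x + s • w ∈ B)
    (hw : ∀ y ∈ B, coordBilin m e y w w < 0 ∧ coordLin (fun x ↦ m x (o x)) e y w < 0) :
    Segment (TimelikeVec m o) univ (e.symm x) (e.symm (x + s • w)) := by
  refine segment_timelikeVec_add he hB hBe hx hxw fun y hy ↦ ?_
  obtain ⟨htimelike, hfuture⟩ := hw y hy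
  simp only [map_smul, smul_apply, smul_eq_mul]
  exact ⟨mul_neg_of_pos_of_neg hs (mul_neg_of_pos_of_neg hs htimelike),
    mul_neg_of_pos_of_neg hs hfuture⟩

variable [IsManifold 𝓘(ℝ, E) ∞ M]

/-- The part of the properties of a time-oriented Lorentz metric, over any model space, that the
local theory uses. The signature enters through `eq_zero`. -/
structure IsLorentz
    (m : ∀ x : M, TangentSpace 𝓘(ℝ, E) x →L[ℝ] TangentSpace 𝓘(ℝ, E) x →L[ℝ] ℝ)
    (o : ∀ x : M, TangentSpace 𝓘(ℝ, E) x) : Prop where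
  symm (x : M) (v w : TangentSpace 𝓘(ℝ, E) x) : m x v w = m x w v
  contMDiff : ContMDiff 𝓘(ℝ, E) (𝓘(ℝ, E).prod 𝓘(ℝ, E →L[ℝ] E →L[ℝ] ℝ)) ∞
      (fun x ↦ Bundle.TotalSpace.mk' (E →L[ℝ] E →L[ℝ] ℝ) x (m x))
  continuous_orient : Continuous (fun x ↦ (⟨x, o x⟩ : TangentBundle 𝓘(ℝ, E) M))
  timelike_orient (x : M) : m x (o x) (o x) < 0
  eq_zero (x : M) (v : TangentSpace 𝓘(ℝ, E) x) : m x v v ≤ 0 → m x (o x) v = 0 → v = 0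

namespace IsLorentz

variable (h : IsLorentz m o) (he : e ∈ IsManifold.maximalAtlas 𝓘(ℝ, E) ∞ M)
include h he

lemma exists_coordBilin_eq {y : E} (hy : y ∈ e.target) :
    ∃ u, coordLin (fun x ↦ m x (o x)) e y = coordBilin m e y u ∧ coordBilin m e y u u < 0 := by
  obtain ⟨u, hu⟩ := (coordVec_bijective he hy).2 (o (e.symm y))
  refine ⟨u, ContinuousLinearMap.ext fun v ↦ ?_, ?_⟩
  · rw [coordLin_apply, coordBilin_apply, hu]
  · rw [coordBilin_apply, hu]
    exact h.timelike_orient _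

lemma eq_zero_of_coordLin_eq_zero {y : E} (hy : y ∈ e.target) (v : E)
    (hv : coordBilin m e y v v ≤ 0) (hv' : coordLin (fun x ↦ m x (o x)) e y v = 0) : v = 0 :=
  (map_eq_zero_iff (coordVec e y) (coordVec_bijective he hy).1).1 (h.eq_zero _ _ hv hv')

variable [FiniteDimensional ℝ E]

lemma contDiffAt_coordBilin {y : E} (hy : y ∈ e.target) : ContDiffAt ℝ ∞ (coordBilin m e) y :=
  (contDiffOn_coordBilin h.contMDiff he).contDiffAt (e.open_target.mem_nhds hy)

lemma continuousAt_coordLin {y : E} (hy : y ∈ e.target) :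
    ContinuousAt (coordLin (fun x ↦ m x (o x)) e) y :=
  (continuousOn_coordLin h.contMDiff h.continuous_orient he).continuousAt
    (e.open_target.mem_nhds hy)

lemma exists_ball_timelike (hp : p ∈ e.source) {u : E} (hGu : coordBilin m e (e p) u u < 0)
    (hNu : coordLin (fun x ↦ m x (o x)) e (e p) u < 0) :
    ∃ r > 0, Metric.ball (e p) r ⊆ e.target ∧
      ∀ y ∈ Metric.ball (e p) r, ∀ w ∈ Metric.ball u r,
        coordBilin m e y w w < 0 ∧ coordLin (fun x ↦ m x (o x)) e y w < 0 := by
  have hep := e.map_source hp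
  have hnear := eventually_timelike (h.contDiffAt_coordBilin he hep).continuousAt
    (h.continuousAt_coordLin he hep) hGu hNu
  obtain ⟨r₁, hr₁, htimelike⟩ := Metric.eventually_nhds_iff_ball.1 hnear
  obtain ⟨r₂, hr₂, htarget⟩ := Metric.mem_nhds_iff.1 (e.open_target.mem_nhds hep)
  refine ⟨min r₁ r₂, lt_min hr₁ hr₂,
    (Metric.ball_subset_ball (min_le_right _ _)).trans htarget, fun y hy w hw ↦ ?_⟩
  have hmem : (y, w) ∈ Metric.ball (e p, u) r₁ := by
    rw [← ball_prod_same]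
    exact ⟨Metric.ball_subset_ball (min_le_left _ _) hy,
      Metric.ball_subset_ball (min_le_left _ _) hw⟩
  exact htimelike (y, w) hmem

omit he in
lemma exists_segment_timelikeVec_mem (p : M) (hU : U ∈ 𝓝 p) :
    ∃ q ∈ U, Segment (TimelikeVec m o) univ p q := by
  have he := IsManifold.chart_mem_maximalAtlas (I := 𝓘(ℝ, E)) (n := ∞) p
  have hp := mem_chart_source E p
  set e := chartAt E p
  obtain ⟨u, hu, huu⟩ := h.exists_coordBilin_eq he (e.map_source hp)
  obtain ⟨r, hr, hrt, hrc⟩ := h.exists_ball_timelike he hp huu (by rwa [hu])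
  have hline : Tendsto (fun s : ℝ ↦ e p + s • u) (𝓝[>] 0) (𝓝 (e p)) := by
    have hcont : ContinuousAt (fun s : ℝ ↦ e p + s • u) 0 := by fun_prop
    simpa [ContinuousAt] using hcont.mono_left nhdsWithin_le_nhds
  obtain ⟨s, hs, hsr, hsU⟩ := (eventually_mem_nhdsWithin.and
    ((hline.eventually_mem (Metric.ball_mem_nhds _ hr)).and
      (hline.eventually_mem (target_inter_preimage_symm_mem_nhds hp hU)))).exists
  refine ⟨e.symm (e p + s • u), hsU.2, ?_⟩
  have hsegment := segment_timelikeVec_add_smul (m := m) (o := o) he hs (convex_ball (e p) r) hrt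
    (Metric.mem_ball_self hr) hsr fun y hy ↦ hrc y hy u (Metric.mem_ball_self hr)
  rwa [e.left_inv hp] at hsegment

lemma eventually_transGen_of_segment_source
    (hpq : Segment (TimelikeVec m o) e.source p q) :
    ∀ᶠ z in 𝓝 q, Relation.TransGen (Segment (TimelikeVec m o) univ) p z := by
  obtain ⟨γ, hγ, rfl, rfl, htimelike⟩ := hpq
  have hsource : MapsTo γ (Icc 0 1) e.source := fun t ht ↦ (htimelike t ht).1
  have hone : (1 : ℝ) ∈ Icc (0 : ℝ) 1 := by simp
  have hvelocity := (congrArg (fun z : TangentBundle 𝓘(ℝ, E) M ↦ TimelikeVec m o z.1 z.2)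
    (coordVec_derivWithin_coord he hγ hsource hone (uniqueDiffOn_Icc one_pos 1 hone))).mpr
    (htimelike 1 hone).2
  obtain ⟨r, hr, hrt, hrc⟩ := h.exists_ball_timelike he (hsource hone) hvelocity.1 hvelocity.2
  -- Replace the end of the curve by a chord: its direction is nearly that of the velocity, so it
  -- remains timelike when its endpoint is moved.
  obtain ⟨t, ht, htr, hchord⟩ := exists_chord_mem_nhds
    ((contDiffOn_coord he hγ hsource 1 hone).differentiableWithinAt one_ne_zero).hasDerivWithinAt
    (Metric.ball_mem_nhds _ hr) (Metric.ball_mem_nhds _ hr)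
  have hinitial : Segment (TimelikeVec m o) univ (γ 0) (γ t) :=
    segment_of_subinterval (P := TimelikeVec m o) (fun _ _ _ hr hv ↦ hv.smul hr) hγ
      (fun s hs ↦ (htimelike s hs).2) le_rfl ht.1 ht.2.le (mapsTo_univ _ _)
  simp only [Function.comp_apply] at htr hchord
  have hcont := e.continuousAt (hsource hone)
  filter_upwards [e.open_source.mem_nhds (hsource hone),
    hcont.eventually_mem (Metric.ball_mem_nhds _ hr), hcont.eventually hchord] with z hz hzr hzv
  have hend : e (γ t) + (1 - t) • ((1 - t)⁻¹ • (e z - e (γ t))) = e z := by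
    rw [smul_inv_smul₀ (sub_pos.2 ht.2).ne', add_sub_cancel]
  have hfinal := segment_timelikeVec_add_smul (m := m) (o := o) (x := e (γ t)) he (sub_pos.2 ht.2)
    (convex_ball (e (γ 1)) r) hrt htr (by rwa [hend]) fun y hy ↦ hrc y hy _ hzv
  rw [hend, e.left_inv hz, e.left_inv (hsource (Ioo_subset_Icc_self ht))] at hfinal
  exact (Relation.TransGen.single hinitial).tail hfinal

omit he in
lemma eventually_transGen_segment (hpq : Segment (TimelikeVec m o) univ p q) :
    ∀ᶠ z in 𝓝 q, Relation.TransGen (Segment (TimelikeVec m o) univ) p z := by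
  have he := IsManifold.chart_mem_maximalAtlas (I := 𝓘(ℝ, E)) (n := ∞) q
  obtain ⟨γ, hγ, rfl, rfl, htimelike⟩ := hpq
  have hsource : γ ⁻¹' (chartAt E (γ 1)).source ∈ 𝓝[≤] 1 := by
    rw [← nhdsWithin_Icc_eq_nhdsLE one_pos]
    exact hγ.continuousOn 1 (by simp)
      ((chartAt E (γ 1)).open_source.mem_nhds (mem_chart_source E (γ 1)))
  obtain ⟨s, hs, hsub⟩ := (mem_nhdsLE_iff_exists_mem_Ico_Ioc_subset one_pos).1 hsource
  obtain ⟨t, hst, ht⟩ := exists_between hs.2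
  have hsegment {V : Set M} {a b : ℝ} (ha : 0 ≤ a) (hab : a < b) (hb : b ≤ 1)
      (hV : MapsTo γ (Icc a b) V) : Segment (TimelikeVec m o) V (γ a) (γ b) :=
    segment_of_subinterval (P := TimelikeVec m o) (fun _ _ _ hr hv ↦ hv.smul hr) hγ
      (fun s hs ↦ (htimelike s hs).2) ha hab hb hV
  exact (h.eventually_transGen_of_segment_source he (hsegment (hs.1.trans hst.le) ht le_rfl
    fun r hr ↦ hsub ⟨hst.trans_le hr.1, hr.2⟩)).mono fun z hz ↦
    hz.head (hsegment le_rfl (hs.1.trans_lt hst) ht.le (mapsTo_univ _ _))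

omit he in
lemma exists_localTime (p : M) :
    ∃ U : Set M, IsOpen U ∧ p ∈ U ∧ ∃ τ : M → ℝ, ∀ x y,
      Segment (CausalVec m o) U x y → τ x < τ y := by
  have he := IsManifold.chart_mem_maximalAtlas (I := 𝓘(ℝ, E)) (n := ∞) p
  have hp := mem_chart_source E p
  set e := chartAt E p
  have hep := e.map_source hp
  obtain ⟨k, hk, hcone⟩ := exists_causal_le (h.contDiffAt_coordBilin he hep).continuousAt
    (h.continuousAt_coordLin he hep) (h.eq_zero_of_coordLin_eq_zero he hep)
  obtain ⟨W, hW, hWopen, hpW⟩ := eventually_nhds_iff.1 hcone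
  refine ⟨e.source ∩ e ⁻¹' W, e.isOpen_inter_preimage hWopen, ⟨hp, hpW⟩,
    fun x ↦ -coordLin (fun x ↦ m x (o x)) e (e p) (e x), fun x y hxy ↦ ?_⟩
  obtain ⟨c, hc, hc0, hc1, hcausal⟩ := hxy.exists_coord he inter_subset_left
  beta_reduce
  rw [← hc0, ← hc1]
  refine lt_of_forall_derivWithin_pos hc (-coordLin (fun x ↦ m x (o x)) e (e p)) fun t ht ↦ ?_
  obtain ⟨htarget, ⟨-, hct⟩, hnonspacelike, hfuture⟩ := hcausal t ht
  rw [mem_preimage, e.right_inv htarget] at hct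
  have hne : derivWithin c (Icc 0 1) t ≠ 0 := fun h0 ↦ by simp [h0] at hfuture
  exact (mul_pos hk (norm_pos_iff.2 hne)).trans_le (hW _ hct _ hnonspacelike hfuture.le)

omit he in
lemma exists_nhds_segment_causalVec (p : M) :
    ∃ U : Set M, IsOpen U ∧ p ∈ U ∧ ∀ x y, Segment (CausalVec m o) U x y →
      ∀ V ∈ 𝓝 y, ∃ z ∈ V, Segment (TimelikeVec m o) univ x z := by
  have he := IsManifold.chart_mem_maximalAtlas (I := 𝓘(ℝ, E)) (n := ∞) p
  have hp := mem_chart_source E p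
  set e := chartAt E p
  have hep := e.map_source hp
  obtain ⟨u, hu, huu⟩ := h.exists_coordBilin_eq he hep
  obtain ⟨k, C, W, hWopen, hpW, hWt, hW⟩ := exists_hasUniformCones (e.open_target.mem_nhds hep)
    ((h.contDiffAt_coordBilin he hep).of_le (by simp)) (h.continuousAt_coordLin he hep)
    (h.eq_zero_of_coordLin_eq_zero he hep) hu huu
  refine ⟨e.source ∩ e ⁻¹' W, e.isOpen_inter_preimage hWopen, ⟨hp, hpW⟩, fun x y hxy V hV ↦ ?_⟩
  obtain ⟨hx, hy⟩ : x ∈ e.source ∧ y ∈ e.source := by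
    obtain ⟨γ, -, rfl, rfl, hγ⟩ := hxy
    exact ⟨(hγ 0 (by simp)).1.1, (hγ 1 (by simp)).1.1⟩
  obtain ⟨c, hc, hc0, hc1, hcausal⟩ := hxy.exists_coord he inter_subset_left
  obtain ⟨a, ha⟩ := hW.exists_timelike_deformation hWopen (fun _ _ _ ↦ h.symm _ _ _) hc
    fun t ht ↦ by
      obtain ⟨htarget, ⟨-, hct⟩, hnonspacelike, hfuture⟩ := hcausal t ht
      rw [mem_preimage, e.right_inv htarget] at hct
      exact ⟨hct, hnonspacelike, hfuture.le⟩
  have hlim : Tendsto (fun ε : ℝ ↦ c 1 + (ε * a) • u) (𝓝[>] 0) (𝓝 (e y)) := by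
    have hcont : ContinuousAt (fun ε : ℝ ↦ c 1 + (ε * a) • u) 0 := by fun_prop
    simpa [ContinuousAt, hc1] using hcont.mono_left (nhdsWithin_le_nhds (s := Ioi 0))
  obtain ⟨ε, ⟨d, hd, hd0, hd1, htimelike⟩, hε⟩ :=
    (ha.and (hlim.eventually_mem (target_inter_preimage_symm_mem_nhds hy hV))).exists
  refine ⟨e.symm (c 1 + (ε * a) • u), hε.2, ?_⟩
  have hsegment := segment_of_coord (P := TimelikeVec m o) (U := univ) he hd fun t ht ↦
    ⟨hWt (htimelike t ht).1, mem_univ _, (htimelike t ht).2⟩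
  rwa [hd0, hd1, hc0, e.left_inv hx] at hsegment

end IsLorentz

end LocalCausality

section LocallyTransitive

/-- The relation `R` holds between the earlier and the later of any two elements of `F` that are
close enough to `t`, as in the definition of a non-spacelike curve. -/
def LocallyRel (R : ℝ → ℝ → Prop) (F : Set ℝ) (t : ℝ) : Prop :=
  ∃ G ∈ 𝓝 t, ∀ s₁ ∈ G ∩ F, ∀ s₂ ∈ G ∩ F, s₁ < s₂ → R s₁ s₂

lemma rel_of_locallyRel {F : Set ℝ} (hF : F.OrdConnected) {R : ℝ → ℝ → Prop}
    (htrans : ∀ a b c, R a b → R b c → R a c) (hloc : ∀ t ∈ F, LocallyRel R F t)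
    {a b : ℝ} (ha : a ∈ F) (hb : b ∈ F) (hab : a < b) : R a b := by
  have hsub : Icc a b ⊆ F := hF.out ha hb
  choose! G hG hR using hloc
  obtain ⟨t, ht0, hmono, ⟨N, hN⟩, hcover⟩ := exists_monotone_Icc_subset_open_cover_Icc hab.le
    (c := fun x : Icc a b ↦ Subtype.val ⁻¹' interior (G x))
    (fun x ↦ isOpen_interior.preimage continuous_subtype_val)
    fun x _ ↦ mem_iUnion.2 ⟨x, mem_interior_iff_mem_nhds.2 (hG x (hsub x.2))⟩
  have hreach : ∀ k, (t k : ℝ) = a ∨ R a (t k) := by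
    intro k
    induction k with
    | zero => exact .inl ht0
    | succ k ih =>
      rcases (hmono k.le_succ).eq_or_lt with heq | hlt
      · rwa [← heq]
      obtain ⟨x, hx⟩ := hcover k
      have hstep : R (t k) (t (k + 1)) := hR x (hsub x.2)
        _ ⟨interior_subset (hx (left_mem_Icc.2 hlt.le)), hsub (t k).2⟩
        _ ⟨interior_subset (hx (right_mem_Icc.2 hlt.le)), hsub (t (k + 1)).2⟩ hlt
      rcases ih with heq | hR'
      · exact .inr (by rwa [heq] at hstep)
      · exact .inr (htrans _ _ _ hR' hstep)
  have hN' : (t N : ℝ) = b := hN N le_rfl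
  rw [← hN'] at hab ⊢
  exact (hreach N).resolve_left hab.ne'

lemma LocallyRel.union {R : ℝ → ℝ → Prop} (htrans : ∀ a b c, R a b → R b c → R a c)
    {a b c t : ℝ} (hab : a ≤ b) (hbc : b ≤ c) (hleft : t ≤ b → LocallyRel R (Icc a b) t)
    (hright : b ≤ t → LocallyRel R (Icc b c) t) : LocallyRel R (Icc a c) t := by
  rcases lt_trichotomy t b with htb | rfl | htb
  · obtain ⟨G, hG, hR⟩ := hleft htb.le
    exact ⟨G ∩ Iio b, inter_mem hG (Iio_mem_nhds htb), fun s₁ hs₁ s₂ hs₂ ↦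
      hR s₁ ⟨hs₁.1.1, hs₁.2.1, hs₁.1.2.le⟩ s₂ ⟨hs₂.1.1, hs₂.2.1, hs₂.1.2.le⟩⟩
  · obtain ⟨G, hG, hR⟩ := hleft le_rfl
    obtain ⟨G', hG', hR'⟩ := hright le_rfl
    refine ⟨G ∩ G', inter_mem hG hG', fun s₁ hs₁ s₂ hs₂ hlt ↦ ?_⟩
    rcases le_or_gt s₂ t with hs₂t | hts₂
    · exact hR s₁ ⟨hs₁.1.1, hs₁.2.1, hlt.le.trans hs₂t⟩ s₂ ⟨hs₂.1.1, hs₂.2.1, hs₂t⟩ hlt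
    rcases le_or_gt t s₁ with hts₁ | hs₁t
    · exact hR' s₁ ⟨hs₁.1.2, hts₁, hs₁.2.2⟩ s₂ ⟨hs₂.1.2, hts₂.le, hs₂.2.2⟩ hlt
    · exact htrans _ _ _
        (hR s₁ ⟨hs₁.1.1, hs₁.2.1, hs₁t.le⟩ t ⟨mem_of_mem_nhds hG, hab, le_rfl⟩ hs₁t)
        (hR' t ⟨mem_of_mem_nhds hG', le_rfl, hbc⟩ s₂ ⟨hs₂.1.2, hts₂.le, hs₂.2.2⟩ hts₂)
  · obtain ⟨G, hG, hR⟩ := hright htb.le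
    exact ⟨G ∩ Ioi b, inter_mem hG (Ioi_mem_nhds htb), fun s₁ hs₁ s₂ hs₂ ↦
      hR s₁ ⟨hs₁.1.1, hs₁.1.2.le, hs₁.2.2⟩ s₂ ⟨hs₂.1.1, hs₂.1.2.le, hs₂.2.2⟩⟩

lemma exists_nhds_mapsTo_Icc {X : Type*} [TopologicalSpace X] {γ : ℝ → X} {F : Set ℝ}
    (hF : F.OrdConnected) (hγ : ContinuousOn γ F) {t : ℝ} (ht : t ∈ F) {U : Set X}
    (hU : U ∈ 𝓝 (γ t)) : ∃ G ∈ 𝓝 t, ∀ s₁ ∈ G ∩ F, ∀ s₂ ∈ G ∩ F, MapsTo γ (Icc s₁ s₂) U := by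
  obtain ⟨δ, hδ, hball⟩ := Metric.mem_nhdsWithin_iff.1 (hγ t ht hU)
  refine ⟨Metric.ball t δ, Metric.ball_mem_nhds _ hδ, fun s₁ hs₁ s₂ hs₂ s hs ↦ hball ⟨?_, ?_⟩⟩
  · rw [Real.ball_eq_Ioo] at *
    exact ⟨hs₁.1.1.trans_le hs.1, hs.2.trans_lt hs₂.1.2⟩
  · exact hF.out hs₁.2 hs₂.2 hs

end LocallyTransitive

section CausalRelations

variable {n : ℕ} {M : Type*} [TopologicalSpace M]
  [ChartedSpace (EuclideanSpace ℝ (Fin (n + 1))) M] [IsManifold (𝓡 (n + 1)) ∞ M]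

namespace Spacetime

variable {g : Spacetime n M}

variable (g) in
lemma isLorentz : IsLorentz (E := EuclideanSpace ℝ (Fin (n + 1))) g.metric g.orient where
  symm := g.symm
  contMDiff := g.contMDiff_metric
  continuous_orient := g.continuous_orient
  timelike_orient := g.timelike_orient
  eq_zero x _ h h' := g.eq_zero_of_metric_eq_zero (g.timelike_orient x) h h'

/-! ### Time reversal -/

variable (g) in
/-- The spacetime with the opposite time orientation. -/
def reverse : Spacetime n M where
  metric := g.metric
  symm := g.symm
  signature := g.signature
  contMDiff_metric := g.contMDiff_metric
  orient x := -g.orient x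
  continuous_orient := by
    have h : ContMDiff (𝓡 (n + 1)) (𝓡 (n + 1)).tangent 0
        (fun x ↦ (⟨x, g.orient x⟩ : TangentBundle (𝓡 (n + 1)) M)) :=
      contMDiff_zero_iff.2 g.continuous_orient
    exact (ContMDiff.neg_section h).continuous
  timelike_orient x := by simpa using g.timelike_orient x

lemma futureTimelike_reverse {x : M} {v : TangentSpace (𝓡 (n + 1)) x} :
    g.reverse.FutureTimelike x v ↔ g.FutureTimelike x (-v) := by
  simp [FutureTimelike, reverse]

lemma futureCausal_reverse {x : M} {v : TangentSpace (𝓡 (n + 1)) x} :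
    g.reverse.FutureCausal x v ↔ g.FutureCausal x (-v) := by
  simp [FutureCausal, reverse]

lemma reverse_reverse : g.reverse.reverse = g := by
  simp [reverse]

lemma TimelikeSegment.reverse {U : Set M} {p q : M} (h : g.TimelikeSegment U p q) :
    g.reverse.TimelikeSegment U q p :=
  Segment.mono (Segment.reverse (P := fun x v ↦ g.FutureTimelike x v) h)
    (fun _ _ h ↦ futureTimelike_reverse.2 h) subset_rfl

lemma CausalSegment.reverse {U : Set M} {p q : M} (h : g.CausalSegment U p q) :
    g.reverse.CausalSegment U q p :=
  Segment.mono (Segment.reverse (P := fun x v ↦ g.FutureCausal x v) h)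
    (fun _ _ h ↦ futureCausal_reverse.2 h) subset_rfl

lemma timelikeSegment_reverse {U : Set M} :
    g.reverse.TimelikeSegment U = Function.swap (g.TimelikeSegment U) := by
  ext p q
  exact ⟨fun h ↦ by simpa [reverse_reverse] using h.reverse, fun h ↦ TimelikeSegment.reverse h⟩

lemma causalSegment_reverse {U : Set M} :
    g.reverse.CausalSegment U = Function.swap (g.CausalSegment U) := by
  ext p q
  exact ⟨fun h ↦ by simpa [reverse_reverse] using h.reverse, fun h ↦ CausalSegment.reverse h⟩

@[simp] lemma chronFuture_reverse (L U : Set M) : g.reverse.chronFuture L U = g.chronPast L U := by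
  simp [chronFuture, chronPast, timelikeSegment_reverse, Relation.transGen_swap]

@[simp] lemma chronPast_reverse (L U : Set M) : g.reverse.chronPast L U = g.chronFuture L U := by
  simp [chronFuture, chronPast, timelikeSegment_reverse, Relation.transGen_swap]

@[simp] lemma causalFuture_reverse (L U : Set M) :
    g.reverse.causalFuture L U = g.causalPast L U := by
  simp [causalFuture, causalPast, causalSegment_reverse, Relation.transGen_swap]

@[simp] lemma causalPast_reverse (L U : Set M) :
    g.reverse.causalPast L U = g.causalFuture L U := by
  simp [causalFuture, causalPast, causalSegment_reverse, Relation.transGen_swap]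

/-! ### Elementary properties of the causal relations -/

lemma mem_chronFuture {p q : M} {U : Set M} :
    q ∈ g.chronFuture {p} U ↔ Relation.TransGen (g.TimelikeSegment U) p q := by
  simp [chronFuture]

lemma mem_chronPast {p q : M} {U : Set M} : p ∈ g.chronPast {q} U ↔ q ∈ g.chronFuture {p} U := by
  simp [chronFuture, chronPast]

lemma mem_causalFuture {p q : M} {U : Set M} :
    q ∈ g.causalFuture {p} U ↔ (q = p ∧ p ∈ U) ∨ Relation.TransGen (g.CausalSegment U) p q := by
  simp only [causalFuture, mem_union, mem_inter_iff, mem_singleton_iff, mem_ofPred_eq,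
    exists_eq_left]
  exact or_congr ⟨fun h ↦ ⟨h.1, h.1 ▸ h.2⟩, fun h ↦ ⟨h.1, h.1 ▸ h.2⟩⟩ Iff.rfl

lemma mem_causalPast {p q : M} {U : Set M} :
    p ∈ g.causalPast {q} U ↔ q ∈ g.causalFuture {p} U := by
  rw [mem_causalFuture]
  simp only [causalPast, mem_union, mem_inter_iff, mem_singleton_iff, mem_ofPred_eq,
    exists_eq_left]
  exact or_congr ⟨fun h ↦ ⟨h.1.symm, h.2⟩, fun h ↦ ⟨h.1.symm, h.2⟩⟩ Iff.rfl

lemma transGen_of_mem_causalFuture {p q : M} {U : Set M} (h : q ∈ g.causalFuture {p} U)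
    (hne : p ≠ q) : Relation.TransGen (g.CausalSegment U) p q :=
  (mem_causalFuture.1 h).resolve_left fun h ↦ hne h.1.symm

lemma mem_causalFuture_of_transGen {p q : M} {U : Set M}
    (h : Relation.TransGen (g.CausalSegment U) p q) : q ∈ g.causalFuture {p} U :=
  mem_causalFuture.2 (Or.inr h)

lemma mem_causalFuture_self (p : M) : p ∈ g.causalFuture {p} univ :=
  mem_causalFuture.2 (Or.inl ⟨rfl, mem_univ _⟩)

lemma mem_causalFuture_trans {p q r : M} {U : Set M} (h : q ∈ g.causalFuture {p} U)
    (h' : r ∈ g.causalFuture {q} U) : r ∈ g.causalFuture {p} U := by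
  rcases mem_causalFuture.1 h with ⟨rfl, -⟩ | hpq
  · exact h'
  rcases mem_causalFuture.1 h' with ⟨rfl, -⟩ | hqr
  · exact h
  · exact mem_causalFuture_of_transGen (hpq.trans hqr)

lemma mem_chronFuture_trans {p q r : M} {U : Set M} (h : q ∈ g.chronFuture {p} U)
    (h' : r ∈ g.chronFuture {q} U) : r ∈ g.chronFuture {p} U :=
  mem_chronFuture.2 ((mem_chronFuture.1 h).trans (mem_chronFuture.1 h'))

lemma TimelikeSegment.causal {p q : M} {U : Set M} (h : g.TimelikeSegment U p q) :
    g.CausalSegment U p q :=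
  Segment.mono (P := fun x v ↦ g.FutureTimelike x v) (Q := fun x v ↦ g.FutureCausal x v) h
    (fun _ _ h ↦ ⟨h.1.le, h.2⟩) subset_rfl

lemma CausalSegment.mono {p q : M} {U V : Set M} (h : g.CausalSegment U p q) (hUV : U ⊆ V) :
    g.CausalSegment V p q :=
  Segment.mono (P := fun x v ↦ g.FutureCausal x v) (Q := fun x v ↦ g.FutureCausal x v) h
    (fun _ _ h ↦ h) hUV

lemma transGen_causalSegment_mono {p q : M} {U V : Set M} (hUV : U ⊆ V)
    (h : Relation.TransGen (g.CausalSegment U) p q) :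
    Relation.TransGen (g.CausalSegment V) p q :=
  Relation.TransGen.mono (fun _ _ (h : g.CausalSegment U _ _) ↦ h.mono hUV) _ _ h

lemma mem_causalFuture_of_mem_chronFuture {p q : M} (h : q ∈ g.chronFuture {p} univ) :
    q ∈ g.causalFuture {p} univ :=
  mem_causalFuture_of_transGen (Relation.TransGen.mono
    (fun _ _ (h : g.TimelikeSegment univ _ _) ↦ h.causal) _ _ (mem_chronFuture.1 h))

lemma exists_mem_chronFuture (p : M) {U : Set M} (hU : U ∈ 𝓝 p) :
    ∃ q ∈ U, q ∈ g.chronFuture {p} univ := by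
  obtain ⟨q, hq, h⟩ := g.isLorentz.exists_segment_timelikeVec_mem p hU
  exact ⟨q, hq, mem_chronFuture.2 (.single h)⟩

lemma exists_mem_chronPast (p : M) {U : Set M} (hU : U ∈ 𝓝 p) :
    ∃ q ∈ U, q ∈ g.chronPast {p} univ := by
  simpa using exists_mem_chronFuture (g := g.reverse) p hU

lemma isOpen_chronFuture (p : M) : IsOpen (g.chronFuture {p} univ) := by
  refine isOpen_iff_mem_nhds.2 fun q hq ↦ ?_
  rw [mem_chronFuture] at hq
  obtain ⟨r, hr, hrq⟩ := (Relation.TransGen.tail'_iff).1 hq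
  filter_upwards [g.isLorentz.eventually_transGen_segment hrq] with z hz
  exact mem_chronFuture.2 (Relation.TransGen.trans_right hr hz)

lemma isOpen_chronPast (p : M) : IsOpen (g.chronPast {p} univ) := by
  simpa using isOpen_chronFuture (g := g.reverse) p

lemma causalSegment_of_subinterval {γ : ℝ → M}
    (hγ : ContMDiffOn 𝓘(ℝ, ℝ) (𝓡 (n + 1)) 1 γ (Icc 0 1)) (h : ∀ t ∈ Icc (0 : ℝ) 1,
      g.FutureCausal (γ t) (mfderivWithin 𝓘(ℝ, ℝ) (𝓡 (n + 1)) γ (Icc 0 1) t (1 : ℝ)))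
    {a b : ℝ} {U : Set M} (ha : 0 ≤ a) (hab : a < b) (hb : b ≤ 1) (hU : MapsTo γ (Icc a b) U) :
    g.CausalSegment U (γ a) (γ b) :=
  segment_of_subinterval (P := fun x v ↦ g.FutureCausal x v)
    (fun _ _ _ hr h ↦ CausalVec.smul h hr) hγ h ha hab hb hU

lemma mem_chronFuture_of_causalSegment {p q r : M} (h : g.CausalSegment univ p q)
    (h' : r ∈ g.chronFuture {q} univ) : r ∈ g.chronFuture {p} univ := by
  obtain ⟨γ, hγ, rfl, rfl, hcausal⟩ := h
  refine rel_of_locallyRel (F := Icc (0 : ℝ) 1)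
    (R := fun s t ↦ r ∈ g.chronFuture {γ t} univ → r ∈ g.chronFuture {γ s} univ) ordConnected_Icc
    (fun a b c hab hbc hr ↦ hab (hbc hr)) (fun t ht ↦ ?_) (by simp) (by simp) one_pos h'
  obtain ⟨U, hUo, hU, hpush⟩ := g.isLorentz.exists_nhds_segment_causalVec (γ t)
  obtain ⟨G, hG, hGU⟩ := exists_nhds_mapsTo_Icc ordConnected_Icc hγ.continuousOn ht
    (hUo.mem_nhds hU)
  refine ⟨G, hG, fun s₁ hs₁ s₂ hs₂ hlt hr ↦ ?_⟩
  have hsegment := causalSegment_of_subinterval hγ (fun t ht ↦ (hcausal t ht).2) hs₁.2.1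
    hlt hs₂.2.2 (hGU _ hs₁ _ hs₂)
  obtain ⟨z, hz, hsz⟩ := hpush _ _ hsegment _ ((isOpen_chronPast r).mem_nhds (mem_chronPast.2 hr))
  exact mem_chronFuture_trans (mem_chronFuture.2 (.single hsz)) (mem_chronPast.1 hz)

lemma mem_chronFuture_of_causal_of_chron {p q r : M} (h : q ∈ g.causalFuture {p} univ)
    (h' : r ∈ g.chronFuture {q} univ) : r ∈ g.chronFuture {p} univ := by
  rcases mem_causalFuture.1 h with ⟨rfl, -⟩ | hc
  · exact h'
  clear h
  induction hc using Relation.TransGen.head_induction_on with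
  | single hseg => exact mem_chronFuture_of_causalSegment hseg h'
  | head hseg _ ih => exact mem_chronFuture_of_causalSegment hseg ih

lemma mem_chronFuture_of_chron_of_causal {p q r : M} (h : q ∈ g.chronFuture {p} univ)
    (h' : r ∈ g.causalFuture {q} univ) : r ∈ g.chronFuture {p} univ := by
  have hdual := mem_chronFuture_of_causal_of_chron (g := g.reverse) (p := r) (q := q) (r := p)
  simp only [causalFuture_reverse, chronFuture_reverse, mem_causalPast, mem_chronPast] at hdual
  exact hdual h' h

end Spacetime

end CausalRelations

section CausalCurves

variable {n : ℕ} {M : Type*} [TopologicalSpace M]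
  [ChartedSpace (EuclideanSpace ℝ (Fin (n + 1))) M] [IsManifold (𝓡 (n + 1)) ∞ M]

namespace Spacetime

variable {g : Spacetime n M}

/-! ### Causal curves -/

lemma nontrivial_Icc_of_lt {a b : ℝ} (h : a < b) : (Icc a b).Nontrivial :=
  ⟨a, left_mem_Icc.2 h.le, b, right_mem_Icc.2 h.le, h.ne⟩

lemma exists_nhds_ne_of_transGen (p : M) :
    ∃ U : Set M, IsOpen U ∧ p ∈ U ∧ ∀ x y, Relation.TransGen (g.CausalSegment U) x y → x ≠ y := by
  obtain ⟨U, hU, hp, τ, hτ⟩ := g.isLorentz.exists_localTime p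
  refine ⟨U, hU, hp, fun x y hxy ↦ ?_⟩
  have hlt : τ x < τ y := by
    induction hxy with
    | single hseg => exact hτ _ _ hseg
    | tail _ hseg ih => exact ih.trans (hτ _ _ hseg)
  exact fun heq ↦ hlt.ne (congrArg τ heq)

lemma isCausalCurve_of_locallyRel {F : Set ℝ} {γ : ℝ → M} (hF : F.OrdConnected)
    (hF' : F.Nontrivial) (hγ : ContinuousOn γ F) (hloc : ∀ t ∈ F, ∀ U : Set M, IsOpen U → γ t ∈ U →
      LocallyRel (fun s₁ s₂ ↦ Relation.TransGen (g.CausalSegment U) (γ s₁) (γ s₂)) F t) :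
    g.IsCausalCurve F γ := by
  refine ⟨hF, hF', hγ, fun t ht U hU htU ↦ ?_⟩
  obtain ⟨V, hV, htV, hne⟩ := exists_nhds_ne_of_transGen (g := g) (γ t)
  obtain ⟨G, hG, hR⟩ := hloc t ht (U ∩ V) (hU.inter hV) ⟨htU, htV⟩
  refine ⟨G, hG, fun s₁ hs₁ s₂ hs₂ hlt ↦ ?_⟩
  have hrel := hR s₁ hs₁ s₂ hs₂ hlt
  exact ⟨hne _ _ (transGen_causalSegment_mono inter_subset_right hrel),
    mem_causalFuture_of_transGen (transGen_causalSegment_mono inter_subset_left hrel)⟩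

lemma IsCausalCurve.locallyRel {F : Set ℝ} {γ : ℝ → M} (h : g.IsCausalCurve F γ) {t : ℝ}
    (ht : t ∈ F) {U : Set M} (hU : IsOpen U) (htU : γ t ∈ U) :
    LocallyRel (fun s₁ s₂ ↦ Relation.TransGen (g.CausalSegment U) (γ s₁) (γ s₂)) F t := by
  obtain ⟨G, hG, hR⟩ := h.2.2.2 t ht U hU htU
  refine ⟨G, hG, fun s₁ hs₁ s₂ hs₂ hlt ↦ ?_⟩
  obtain ⟨hne, hmem⟩ := hR s₁ hs₁ s₂ hs₂ hlt
  exact transGen_of_mem_causalFuture hmem hne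

lemma IsCausalCurve.congr {F : Set ℝ} {γ γ' : ℝ → M} (h : g.IsCausalCurve F γ)
    (hγ : EqOn γ' γ F) : g.IsCausalCurve F γ' := by
  obtain ⟨hF, hF', hcont, hcausal⟩ := h
  refine ⟨hF, hF', hcont.congr hγ, fun t ht U hU htU ↦ ?_⟩
  obtain ⟨G, hG, hR⟩ := hcausal t ht U hU (hγ ht ▸ htU)
  refine ⟨G, hG, fun s₁ hs₁ s₂ hs₂ hlt ↦ ?_⟩
  rw [hγ hs₁.2, hγ hs₂.2]
  exact hR s₁ hs₁ s₂ hs₂ hlt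

lemma IsCausalCurve.comp {F : Set ℝ} {γ : ℝ → M} (h : g.IsCausalCurve F γ) {f : ℝ → ℝ}
    (hf : Continuous f) (hmono : StrictMono f) (hne : (f ⁻¹' F).Nontrivial) :
    g.IsCausalCurve (f ⁻¹' F) (γ ∘ f) := by
  obtain ⟨hF, -, hcont, hcausal⟩ := h
  refine ⟨hF.preimage_mono hmono.monotone, hne, hcont.comp hf.continuousOn (mapsTo_preimage f F),
    fun t ht U hU htU ↦ ?_⟩
  obtain ⟨G, hG, hR⟩ := hcausal (f t) ht U hU htU
  exact ⟨f ⁻¹' G, hf.continuousAt.preimage_mem_nhds hG, fun s₁ hs₁ s₂ hs₂ hlt ↦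
    hR _ hs₁ _ hs₂ (hmono hlt)⟩

lemma IsCausalCurve.reverse {F : Set ℝ} {γ : ℝ → M} (h : g.IsCausalCurve F γ) :
    g.reverse.IsCausalCurve (Neg.neg ⁻¹' F) (fun t ↦ γ (-t)) := by
  obtain ⟨hF, hF', hcont, hcausal⟩ := h
  refine ⟨hF.preimage_anti fun _ _ hle ↦ neg_le_neg hle, hF'.preimage neg_surjective,
    hcont.comp continuousOn_neg (mapsTo_preimage _ F), fun t ht U hU htU ↦ ?_⟩
  obtain ⟨G, hG, hR⟩ := hcausal (-t) ht U hU htU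
  refine ⟨Neg.neg ⁻¹' G, continuousAt_neg.preimage_mem_nhds hG, fun s₁ hs₁ s₂ hs₂ hlt ↦ ?_⟩
  obtain ⟨hne, hmem⟩ := hR (-s₂) hs₂ (-s₁) hs₁ (neg_lt_neg hlt)
  exact ⟨hne.symm, by rwa [causalFuture_reverse, mem_causalPast]⟩

lemma IsCausalCurve.union {a b c : ℝ} (hab : a < b) (hbc : b < c) {γ : ℝ → M}
    (h : g.IsCausalCurve (Icc a b) γ) (h' : g.IsCausalCurve (Icc b c) γ) :
    g.IsCausalCurve (Icc a c) γ := by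
  have hcont : ContinuousOn γ (Icc a c) :=
    Icc_union_Icc_eq_Icc hab.le hbc.le ▸
      h.2.2.1.union_of_isClosed h'.2.2.1 isClosed_Icc isClosed_Icc
  exact isCausalCurve_of_locallyRel ordConnected_Icc (nontrivial_Icc_of_lt (hab.trans hbc)) hcont
    fun t ht U hU htU ↦ LocallyRel.union (fun _ _ _ ↦ Relation.TransGen.trans) hab.le hbc.le
      (fun htb ↦ h.locallyRel ⟨ht.1, htb⟩ hU htU) fun hbt ↦ h'.locallyRel ⟨hbt, ht.2⟩ hU htU

lemma IsCausalCurve.exists_append {b c : ℝ} (hb : 0 < b) (hc : 0 < c) {γ η : ℝ → M}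
    (hγ : g.IsCausalCurve (Icc 0 b) γ) (hη : g.IsCausalCurve (Icc 0 c) η) (h : γ b = η 0) :
    ∃ ζ : ℝ → M, g.IsCausalCurve (Icc 0 (b + c)) ζ ∧ ζ 0 = γ 0 ∧ ζ b = γ b ∧
      ζ (b + c) = η c := by
  have hpre : (fun t ↦ t - b) ⁻¹' Icc 0 c = Icc b (b + c) := by
    ext t
    simp only [mem_preimage, mem_Icc]
    constructor <;> rintro ⟨h₁, h₂⟩ <;> constructor <;> linarith
  have hshift := hη.comp (f := fun t ↦ t - b) (by fun_prop)
    (fun s t h ↦ sub_lt_sub_right h b) (by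
      rw [hpre]; exact nontrivial_Icc_of_lt (by linarith))
  rw [hpre] at hshift
  refine ⟨fun t ↦ if t ≤ b then γ t else η (t - b),
    IsCausalCurve.union hb (by linarith) (hγ.congr fun t ht ↦ by simp [ht.2])
      (hshift.congr fun t ht ↦ ?_), by simp [hb.le], by simp, by simp [hc]⟩
  rcases ht.1.eq_or_lt with rfl | hlt
  · simp [h]
  · simp [not_le.2 hlt]

lemma CausalSegment.exists_isCausalCurve {p q : M} {U : Set M} (h : g.CausalSegment U p q) :
    ∃ γ : ℝ → M, g.IsCausalCurve (Icc 0 1) γ ∧ γ 0 = p ∧ γ 1 = q := by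
  obtain ⟨γ, hγ, rfl, rfl, hcausal⟩ := h
  refine ⟨γ, isCausalCurve_of_locallyRel ordConnected_Icc (nontrivial_Icc_of_lt one_pos)
    hγ.continuousOn fun t ht V hV htV ↦ ?_, rfl, rfl⟩
  obtain ⟨G, hG, hGV⟩ := exists_nhds_mapsTo_Icc ordConnected_Icc hγ.continuousOn ht
    (hV.mem_nhds htV)
  exact ⟨G, hG, fun s₁ hs₁ s₂ hs₂ hlt ↦ .single <| causalSegment_of_subinterval hγ
    (fun t ht ↦ (hcausal t ht).2) hs₁.2.1 hlt hs₂.2.2 (hGV _ hs₁ _ hs₂)⟩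

lemma exists_isCausalCurve {p q : M} {U : Set M}
    (h : Relation.TransGen (g.CausalSegment U) p q) :
    ∃ b > 0, ∃ γ : ℝ → M, g.IsCausalCurve (Icc 0 b) γ ∧ γ 0 = p ∧ γ b = q := by
  induction h with
  | single hseg => exact ⟨1, one_pos, hseg.exists_isCausalCurve⟩
  | tail _ hseg ih =>
    obtain ⟨b, hb, γ, hγ, hγ0, hγb⟩ := ih
    obtain ⟨η, hη, hη0, hη1⟩ := hseg.exists_isCausalCurve
    obtain ⟨ζ, hζ, hζ0, -, hζ1⟩ := hγ.exists_append hb one_pos hη (hγb.trans hη0.symm)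
    exact ⟨b + 1, by linarith, ζ, hζ, hζ0.trans hγ0, hζ1.trans hη1⟩

lemma IsCausalCurve.transGen {F : Set ℝ} {γ : ℝ → M} (h : g.IsCausalCurve F γ) {U : Set M}
    (hU : IsOpen U) {a b : ℝ} (ha : a ∈ F) (hb : b ∈ F) (hab : a < b)
    (hγ : MapsTo γ (Icc a b) U) : Relation.TransGen (g.CausalSegment U) (γ a) (γ b) := by
  have hsub : Icc a b ⊆ F := h.1.out ha hb
  refine rel_of_locallyRel (F := Icc a b)
    (R := fun s t ↦ Relation.TransGen (g.CausalSegment U) (γ s) (γ t)) ordConnected_Icc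
    (fun _ _ _ ↦ Relation.TransGen.trans) (fun t ht ↦ ?_) (left_mem_Icc.2 hab.le)
    (right_mem_Icc.2 hab.le) hab
  obtain ⟨G, hG, hR⟩ := h.locallyRel (hsub ht) hU (hγ ht)
  exact ⟨G, hG, fun s₁ hs₁ s₂ hs₂ ↦ hR s₁ ⟨hs₁.1, hsub hs₁.2⟩ s₂ ⟨hs₂.1, hsub hs₂.2⟩⟩

lemma IsCausalCurve.mem_causalFuture {F : Set ℝ} {γ : ℝ → M} (h : g.IsCausalCurve F γ)
    {a b : ℝ} (ha : a ∈ F) (hb : b ∈ F) (hab : a ≤ b) : γ b ∈ g.causalFuture {γ a} univ := by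
  rcases hab.eq_or_lt with rfl | hab
  · exact mem_causalFuture_self _
  · exact mem_causalFuture_of_transGen (h.transGen isOpen_univ ha hb hab (mapsTo_univ _ _))

/-! ### Strong causality -/

lemma StronglyCausalAt.reverse {p : M} (h : g.StronglyCausalAt p) :
    g.reverse.StronglyCausalAt p := by
  intro U hU
  obtain ⟨V, hV, hVU, h⟩ := h U hU
  refine ⟨V, hV, hVU, fun F γ hγ ↦ ?_⟩
  have hreverse := hγ.reverse
  rw [reverse_reverse] at hreverse
  convert! (h _ _ hreverse).preimage_anti (f := fun t : ℝ ↦ -t) fun _ _ hle ↦ neg_le_neg hle using 1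
  ext t
  simp

lemma IsGloballyHyperbolic.reverse (h : g.IsGloballyHyperbolic) :
    g.reverse.IsGloballyHyperbolic := by
  refine ⟨fun p ↦ (h.1 p).reverse, fun p q ↦ ?_⟩
  rw [causalFuture_reverse, causalPast_reverse, inter_comm]
  exact h.2 q p

lemma StronglyCausalAt.eq_of_mem_causalFuture [T2Space M] {p q : M} (h : g.StronglyCausalAt p)
    (hpq : q ∈ g.causalFuture {p} univ) (hqp : p ∈ g.causalFuture {q} univ) : p = q := by
  by_contra hne
  obtain ⟨V, hV, hVU, hconn⟩ := h {q}ᶜ (isOpen_compl_singleton.mem_nhds hne)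
  obtain ⟨b, hb, γ, hγ, hγ0, hγb⟩ := exists_isCausalCurve (transGen_of_mem_causalFuture hpq hne)
  obtain ⟨c, hc, η, hη, hη0, hηc⟩ :=
    exists_isCausalCurve (transGen_of_mem_causalFuture hqp (Ne.symm hne))
  obtain ⟨ζ, hζ, hζ0, hζb, hζc⟩ := hγ.exists_append hb hc hη (hγb.trans hη0.symm)
  have hpV := mem_of_mem_nhds hV
  have hmem := (hconn _ _ hζ).out (x := 0) ⟨⟨le_rfl, by linarith⟩, by rwa [hζ0, hγ0]⟩ (y := b + c)
    ⟨⟨by linarith, le_rfl⟩, by rwa [hζc, hηc]⟩ ⟨hb.le, by linarith⟩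
  exact hVU hmem.2 (hζb.trans hγb)

lemma StronglyCausalAt.exists_nhds_causalFuture {p : M} (h : g.StronglyCausalAt p) {U : Set M}
    (hU : IsOpen U) (hp : p ∈ U) :
    ∃ V ∈ 𝓝 p, ∀ x ∈ V, ∀ y ∈ V, y ∈ g.causalFuture {x} univ → y ∈ g.causalFuture {x} U := by
  obtain ⟨V, hV, hVU, hconn⟩ := h U (hU.mem_nhds hp)
  refine ⟨V, hV, fun x hx y hy hxy ↦ ?_⟩
  rcases eq_or_ne x y with rfl | hne
  · exact mem_causalFuture.2 (Or.inl ⟨rfl, hVU hx⟩)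
  obtain ⟨b, hb, γ, hγ, rfl, rfl⟩ := exists_isCausalCurve (transGen_of_mem_causalFuture hxy hne)
  have hγV : MapsTo γ (Icc 0 b) V := fun t ht ↦ ((hconn _ _ hγ).out (x := 0)
    ⟨⟨le_rfl, hb.le⟩, hx⟩ (y := b) ⟨⟨hb.le, le_rfl⟩, hy⟩ ht).2
  exact mem_causalFuture_of_transGen
    (hγ.transGen hU ⟨le_rfl, hb.le⟩ ⟨hb.le, le_rfl⟩ hb (hγV.mono_right hVU))

lemma isCausalCurve_of_forall_causalFuture (h : ∀ p, g.StronglyCausalAt p) {F : Set ℝ}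
    {γ : ℝ → M} (hF : F.OrdConnected) (hF' : F.Nontrivial) (hγ : ContinuousOn γ F)
    (hlt : ∀ s ∈ F, ∀ t ∈ F, s < t → γ s ≠ γ t ∧ γ t ∈ g.causalFuture {γ s} univ) :
    g.IsCausalCurve F γ := by
  refine ⟨hF, hF', hγ, fun t ht U hU htU ↦ ?_⟩
  obtain ⟨V, hV, hVU⟩ := (h (γ t)).exists_nhds_causalFuture hU htU
  obtain ⟨G, hG, hGV⟩ := mem_nhdsWithin_iff_exists_mem_nhds_inter.1 (hγ t ht hV)
  exact ⟨G, hG, fun s₁ hs₁ s₂ hs₂ h12 ↦ ⟨(hlt _ hs₁.2 _ hs₂.2 h12).1,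
    hVU _ (hGV hs₁) _ (hGV hs₂) (hlt _ hs₁.2 _ hs₂.2 h12).2⟩⟩

/-! ### Global hyperbolicity -/

namespace IsGloballyHyperbolic

variable (hg : g.IsGloballyHyperbolic)
include hg

lemma eq_of_mem_causalFuture [T2Space M] {p q : M} (hpq : q ∈ g.causalFuture {p} univ)
    (hqp : p ∈ g.causalFuture {q} univ) : p = q :=
  (hg.1 p).eq_of_mem_causalFuture hpq hqp

lemma isClosed_causalFuture [T2Space M] (p : M) : IsClosed (g.causalFuture {p} univ) := by
  refine isClosed_of_closure_subset fun r hr ↦ ?_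
  obtain ⟨q, -, hq⟩ := exists_mem_chronFuture (g := g) r univ_mem
  by_contra hrp
  have hopen : g.chronPast {q} univ ∩ (g.causalFuture {p} univ ∩ g.causalPast {q} univ)ᶜ ∈ 𝓝 r :=
    inter_mem ((isOpen_chronPast q).mem_nhds (mem_chronPast.2 hq))
      ((hg.2 p q).isClosed.isOpen_compl.mem_nhds fun h ↦ hrp h.1)
  obtain ⟨z, ⟨hzq, hz⟩, hpz⟩ := mem_closure_iff_nhds.1 hr _ hopen
  exact hz ⟨hpz, mem_causalPast.2 (mem_causalFuture_of_mem_chronFuture (mem_chronPast.1 hzq))⟩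

lemma isClosed_causalPast [T2Space M] (p : M) : IsClosed (g.causalPast {p} univ) := by
  simpa using hg.reverse.isClosed_causalFuture p

lemma isClosed_causalRel [T2Space M] :
    IsClosed {x : M × M | x.2 ∈ g.causalFuture {x.1} univ} := by
  refine isClosed_of_closure_subset fun ⟨p, q⟩ hpq ↦ ?_
  have hpast : ∀ p' ∈ g.chronPast {p} univ, q ∈ g.causalFuture {p'} univ := by
    intro p' hp'
    rw [← (hg.isClosed_causalFuture p').closure_eq, mem_closure_iff_nhds]
    intro U hU
    obtain ⟨⟨x, y⟩, ⟨hx, hy⟩, hxy⟩ := mem_closure_iff_nhds.1 hpq _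
      (prod_mem_nhds ((isOpen_chronFuture p').mem_nhds (mem_chronPast.1 hp')) hU)
    exact ⟨y, hy, mem_causalFuture_trans (mem_causalFuture_of_mem_chronFuture hx) hxy⟩
  change q ∈ g.causalFuture {p} univ
  rw [← mem_causalPast, ← (hg.isClosed_causalPast q).closure_eq, mem_closure_iff_nhds]
  intro U hU
  obtain ⟨p', hp'U, hp'⟩ := exists_mem_chronPast (g := g) p hU
  exact ⟨p', hp'U, mem_causalPast.2 (hpast p' hp')⟩

end IsGloballyHyperbolic

end Spacetime

end CausalCurves

/-! ### Second countability -/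

lemma exists_compacts_forall_subset {ι X : Type*} [TopologicalSpace X] {V K : ι → Set X}
    (hV : LocallyFinite V) (hVK : ∀ i, V i ⊆ K i) (hK : ∀ i, IsCompact (K i))
    (C : TopologicalSpace.Compacts X) :
    ∃ D : TopologicalSpace.Compacts X, ∀ i, (V i ∩ C).Nonempty → V i ⊆ D :=
  have hfin := hV.finite_nonempty_inter_compact C.isCompact
  ⟨⟨⋃ i ∈ {i | (V i ∩ C).Nonempty}, K i, hfin.isCompact_biUnion fun i _ ↦ hK i⟩, fun i hi ↦
    (hVK i).trans (subset_biUnion_of_mem (u := K) (x := i) hi)⟩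

lemma isClopen_iUnion_of_cover {ι X : Type*} [TopologicalSpace X] {V : ι → Set X}
    (hV : ∀ i, IsOpen (V i)) (hcover : ∀ x, ∃ i, x ∈ V i) {C : ℕ → Set X}
    (hC : ∀ k i, (V i ∩ C k).Nonempty → V i ⊆ C (k + 1)) : IsClopen (⋃ k, C k) := by
  refine ⟨isOpen_compl_iff.1 (isOpen_iff_mem_nhds.2 fun x hx ↦ ?_),
    isOpen_iff_mem_nhds.2 fun x hx ↦ ?_⟩ <;> obtain ⟨i, hi⟩ := hcover x
  · refine mem_of_superset ((hV i).mem_nhds hi) fun y hy hyC ↦ hx ?_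
    obtain ⟨k, hk⟩ := mem_iUnion.1 hyC
    exact mem_iUnion.2 ⟨k + 1, hC k i ⟨y, hy, hk⟩ hi⟩
  · obtain ⟨k, hk⟩ := mem_iUnion.1 hx
    exact mem_of_superset ((hV i).mem_nhds hi)
      ((hC k i ⟨x, hi, hk⟩).trans (subset_iUnion C (k + 1)))

lemma sigmaCompactSpace_of_paracompactSpace (X : Type*) [TopologicalSpace X]
    [WeaklyLocallyCompactSpace X] [ParacompactSpace X] [ConnectedSpace X] :
    SigmaCompactSpace X := by
  choose K hK hKn using fun x : X ↦ exists_compact_mem_nhds x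
  obtain ⟨V, hVo, hcover, hVf, hVK⟩ := precise_refinement (fun x ↦ interior (K x))
    (fun x ↦ isOpen_interior) (eq_univ_of_forall fun x ↦
      mem_iUnion.2 ⟨x, mem_interior_iff_mem_nhds.2 (hKn x)⟩)
  choose D hD using exists_compacts_forall_subset hVf (fun i ↦ (hVK i).trans interior_subset) hK
  obtain ⟨x₀⟩ := (inferInstance : Nonempty X)
  let C : ℕ → TopologicalSpace.Compacts X := fun k ↦ D^[k] {x₀}
  have hclopen : IsClopen (⋃ k, (C k : Set X)) :=
    isClopen_iUnion_of_cover hVo (fun x ↦ mem_iUnion.1 (hcover ▸ mem_univ x)) fun k i hi ↦ by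
      simpa only [C, Function.iterate_succ_apply'] using hD _ i hi
  exact ⟨⟨fun k ↦ C k, fun k ↦ (C k).isCompact,
    hclopen.eq_univ ⟨x₀, mem_iUnion.2 ⟨0, mem_singleton x₀⟩⟩⟩⟩

section Riemannian

open Bundle

variable {E : Type*} [NormedAddCommGroup E] [NormedSpace ℝ E]

lemma exists_mul_sq_norm_le_of_forall_pos [FiniteDimensional ℝ E] {A : E →L[ℝ] E →L[ℝ] ℝ}
    (hpos : ∀ v, v ≠ 0 → 0 < A v v) : ∃ k > 0, ∀ v, k * ‖v‖ ^ 2 ≤ A v v := by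
  rcases subsingleton_or_nontrivial E with _ | _
  · exact ⟨1, one_pos, fun v ↦ by simp [Subsingleton.elim v 0]⟩
  have hcont : Continuous fun v ↦ A v v := by fun_prop
  obtain ⟨w, hw, hmin⟩ := (isCompact_sphere (0 : E) 1).exists_isMinOn
    (NormedSpace.sphere_nonempty.2 zero_le_one) hcont.continuousOn
  refine ⟨A w w, hpos w (ne_zero_of_mem_unit_sphere ⟨w, hw⟩), fun v ↦ ?_⟩
  rcases eq_or_ne v 0 with rfl | hv
  · simp
  have hnorm : 0 < ‖v‖ := norm_pos_iff.2 hv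
  calc A w w * ‖v‖ ^ 2 ≤ A (‖v‖⁻¹ • v) (‖v‖⁻¹ • v) * ‖v‖ ^ 2 := by
        gcongr
        exact hmin (by simp [norm_smul, hnorm.ne'])
    _ = A v v := by
        simp only [map_smul, smul_apply, smul_eq_mul]
        field_simp

lemma isBounded_setOf_lt_one_of_forall_pos [FiniteDimensional ℝ E] {A : E →L[ℝ] E →L[ℝ] ℝ}
    (hpos : ∀ v, v ≠ 0 → 0 < A v v) : Bornology.IsBounded {v | A v v < 1} := by
  obtain ⟨k, hk, hle⟩ := exists_mul_sq_norm_le_of_forall_pos hpos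
  refine (Metric.isBounded_iff_subset_closedBall 0).2 ⟨√k⁻¹, fun v hv ↦ ?_⟩
  rw [mem_closedBall_zero_iff]
  refine Real.le_sqrt_of_sq_le ?_
  rw [inv_eq_one_div, le_div_iff₀' hk]
  exact (hle v).trans (le_of_lt hv)

variable {M : Type*} [TopologicalSpace M] [ChartedSpace E M]

/-- The Riemannian metric that is obtained from a Lorentz metric by reversing the sign in the
direction of a timelike vector field. -/
def riemannianOfLorentz
    (m : ∀ x : M, TangentSpace 𝓘(ℝ, E) x →L[ℝ] TangentSpace 𝓘(ℝ, E) x →L[ℝ] ℝ)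
    (o : ∀ x : M, TangentSpace 𝓘(ℝ, E) x) (x : M) :
    TangentSpace 𝓘(ℝ, E) x →L[ℝ] TangentSpace 𝓘(ℝ, E) x →L[ℝ] ℝ :=
  m x - (2 / m x (o x) (o x)) • (m x (o x)).smulRight (m x (o x))

variable {m : ∀ x : M, TangentSpace 𝓘(ℝ, E) x →L[ℝ] TangentSpace 𝓘(ℝ, E) x →L[ℝ] ℝ}
    {o : ∀ x : M, TangentSpace 𝓘(ℝ, E) x}

lemma riemannianOfLorentz_apply (x : M) (v w : TangentSpace 𝓘(ℝ, E) x) :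
    riemannianOfLorentz m o x v w =
      m x v w - 2 / m x (o x) (o x) * (m x (o x) v * m x (o x) w) := by
  simp [riemannianOfLorentz]

variable [IsManifold 𝓘(ℝ, E) ∞ M]

namespace IsLorentz

lemma riemannianOfLorentz_pos (h : IsLorentz m o) (x : M) (v : TangentSpace 𝓘(ℝ, E) x)
    (hv : v ≠ 0) : 0 < riemannianOfLorentz m o x v v := by
  set a := m x (o x) (o x) with ha
  have ha_neg : a < 0 := h.timelike_orient x
  obtain ⟨l, w, hvw, hw⟩ : ∃ (l : ℝ) (w : TangentSpace 𝓘(ℝ, E) x),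
      v = l • o x + w ∧ m x (o x) w = 0 := by
    refine ⟨m x (o x) v / a, v - (m x (o x) v / a) • o x, (add_sub_cancel _ _).symm, ?_⟩
    rw [map_sub, map_smul, smul_eq_mul, div_mul_cancel₀ _ ha_neg.ne, sub_self]
  have hlv : m x (o x) v = l * a := by
    rw [hvw, map_add, map_smul, hw, add_zero, smul_eq_mul]
  have hvv : m x v v = l ^ 2 * a + m x w w := by
    have hwo : m x w (o x) = 0 := (h.symm x w (o x)).trans hw
    simp only [hvw, map_add, map_smul, add_apply, smul_apply, smul_eq_mul, hw, hwo, ← ha]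
    ring
  have hsplit : riemannianOfLorentz m o x v v = m x w w + l ^ 2 * -a := by
    rw [riemannianOfLorentz_apply, ← ha, hlv, hvv]
    field_simp
    ring
  rw [hsplit]
  rcases lt_or_ge 0 (m x w w) with hpos | hnonpos
  · exact add_pos_of_pos_of_nonneg hpos (mul_nonneg (sq_nonneg l) (neg_pos.2 ha_neg).le)
  · have hw0 : w = 0 := h.eq_zero x w hnonpos hw
    have hl : l ≠ 0 := by
      rintro rfl
      exact hv (by rw [hvw, hw0, zero_smul, add_zero])
    simpa [hw0] using mul_pos (sq_pos_of_ne_zero hl) (neg_pos.2 ha_neg)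

lemma continuousOn_apply₂ (h : IsLorentz m o) {s : Set M} {v w : ∀ x : M, TangentSpace 𝓘(ℝ, E) x}
    (hv : ContinuousOn (fun x ↦ TotalSpace.mk' E x (v x)) s)
    (hw : ContinuousOn (fun x ↦ TotalSpace.mk' E x (w x)) s) :
    ContinuousOn (fun x ↦ m x (v x) (w x)) s := fun x hx ↦
  ((FiberBundle.continuousWithinAt_totalSpace ℝ _).1
    ((h.contMDiff.continuous.continuousOn.clm_bundle_apply₂ (F₁ := E) (F₂ := E)
      (E₃ := Bundle.Trivial M ℝ) (F₃ := ℝ) hv hw) x hx)).2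

lemma continuousOn_riemannianOfLorentz_apply₂ (h : IsLorentz m o) {s : Set M}
    {v w : ∀ x : M, TangentSpace 𝓘(ℝ, E) x}
    (hv : ContinuousOn (fun x ↦ TotalSpace.mk' E x (v x)) s)
    (hw : ContinuousOn (fun x ↦ TotalSpace.mk' E x (w x)) s) :
    ContinuousOn (fun x ↦ riemannianOfLorentz m o x (v x) (w x)) s := by
  have ho : ContinuousOn (fun x ↦ TotalSpace.mk' E x (o x)) s := h.continuous_orient.continuousOn
  simp only [riemannianOfLorentz_apply]
  exact (h.continuousOn_apply₂ hv hw).sub ((continuousOn_const.div (h.continuousOn_apply₂ ho ho)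
    fun x _ ↦ (h.timelike_orient x).ne).mul
      ((h.continuousOn_apply₂ ho hv).mul (h.continuousOn_apply₂ ho hw)))

variable [FiniteDimensional ℝ E]

lemma continuous_riemannianOfLorentz (h : IsLorentz m o) :
    Continuous (fun x ↦ TotalSpace.mk' (E →L[ℝ] E →L[ℝ] ℝ) x (riemannianOfLorentz m o x)) := by
  refine continuous_iff_continuousAt.2 fun x₀ ↦
    (continuousAt_hom_bundle (RingHom.id ℝ) _).2 ⟨continuousAt_id, ?_⟩
  set t := trivializationAt E (TangentSpace 𝓘(ℝ, E) : M → Type _) x₀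
  have hx₀ : x₀ ∈ t.baseSet := FiberBundle.mem_baseSet_trivializationAt' x₀
  refine ContinuousOn.continuousAt (s := t.baseSet) ?_ (t.open_baseSet.mem_nhds hx₀)
  refine continuousOn_clm_apply.2 fun u ↦ continuousOn_clm_apply.2 fun w ↦ ?_
  have hsymm (u : E) : ContinuousOn (fun x ↦ TotalSpace.mk' E x (t.symm x u)) t.baseSet :=
    t.continuousOn_symm.comp (f := fun x ↦ (x, u)) (by fun_prop) fun x hx ↦ ⟨hx, mem_univ _⟩
  refine (h.continuousOn_riemannianOfLorentz_apply₂ (hsymm u) (hsymm w)).congr fun x hx ↦ ?_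
  rw [inCoordinates_apply_eq₂ hx hx (mem_univ _)]
  simp only [Trivial.fiberBundle_trivializationAt', Trivial.linearMapAt_trivialization]
  rfl

/-- The continuous metric tensor of `riemannianOfLorentz`, whose distance makes the manifold
metrizable. -/
def continuousRiemannianMetric (h : IsLorentz m o) :
    ContinuousRiemannianMetric E (TangentSpace 𝓘(ℝ, E) : M → Type _) where
  inner := riemannianOfLorentz m o
  symm x v w := by
    rw [riemannianOfLorentz_apply, riemannianOfLorentz_apply, h.symm x v w, mul_comm (m x (o x) v)]
  pos := h.riemannianOfLorentz_pos
  isVonNBounded x := NormedSpace.isVonNBounded_of_isBounded (E := E) ℝ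
    (isBounded_setOf_lt_one_of_forall_pos (E := E) (h.riemannianOfLorentz_pos x))
  continuous := h.continuous_riemannianOfLorentz

lemma secondCountableTopology [T2Space M] [ConnectedSpace M] (h : IsLorentz m o) :
    SecondCountableTopology M := by
  let _ : RiemannianBundle (TangentSpace 𝓘(ℝ, E) : M → Type _) :=
    ⟨h.continuousRiemannianMetric.toRiemannianMetric⟩
  have : LocallyCompactSpace M := ChartedSpace.locallyCompactSpace E M
  have : IsManifold 𝓘(ℝ, E) 1 M := .of_le (n := ∞) (by simp)
  let _ : EMetricSpace M := EMetricSpace.ofRiemannianMetric 𝓘(ℝ, E) M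
  have : SigmaCompactSpace M := sigmaCompactSpace_of_paracompactSpace M
  exact ChartedSpace.secondCountable_of_sigmaCompact E M

end IsLorentz

end Riemannian

namespace Spacetime

lemma secondCountableTopology {n : ℕ} {M : Type*} [TopologicalSpace M]
    [ChartedSpace (EuclideanSpace ℝ (Fin (n + 1))) M] [IsManifold (𝓡 (n + 1)) ∞ M] [T2Space M]
    [ConnectedSpace M] (g : Spacetime n M) : SecondCountableTopology M :=
  g.isLorentz.secondCountableTopology

end Spacetime

/-! ### Null sets and the volume functions -/

section NullSets

section Measurability

variable {X Y : Type*} [TopologicalSpace X] [MeasurableSpace X] [BorelSpace X]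
  [TopologicalSpace Y] [MeasurableSpace Y] [BorelSpace Y]

lemma measurableSet_image_of_subset_source {e : OpenPartialHomeomorph X Y} {A : Set X}
    (hA : A ⊆ e.source) (hmeas : MeasurableSet A) : MeasurableSet (e '' A) := by
  have hpre : MeasurableSet (e.target.domRestrict e.symm ⁻¹' A) :=
    (continuousOn_iff_continuous_domRestrict.1 e.continuousOn_symm).measurable hmeas
  have himage := e.open_target.measurableSet.subtype_image hpre
  rwa [Set.domRestrict_eq, preimage_comp, Subtype.image_preimage_coe,
    ← OpenPartialHomeomorph.image_source_inter_eq', inter_eq_right.2 hA] at himage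

lemma map_symm_restrict_target_eq_zero_iff (ν : Measure Y) (e : OpenPartialHomeomorph X Y)
    {A : Set X} (hA : MeasurableSet A) :
    (ν.restrict e.target).map e.symm A = 0 ↔ ν (e '' (e.source ∩ A)) = 0 := by
  have htarget : MeasurableSet e.target := e.open_target.measurableSet
  rw [Measure.map_apply_of_aemeasurable (e.continuousOn_symm.aemeasurable htarget) hA,
    Measure.restrict_apply₀' htarget.nullMeasurableSet,
    OpenPartialHomeomorph.image_source_inter_eq', inter_comm]

end Measurability

variable {E : Type*} [NormedAddCommGroup E] [NormedSpace ℝ E]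
  {M : Type*} [TopologicalSpace M] [ChartedSpace E M] {e e' : OpenPartialHomeomorph M E}

lemma differentiableOn_transition (he : e ∈ IsManifold.maximalAtlas 𝓘(ℝ, E) ∞ M)
    (he' : e' ∈ IsManifold.maximalAtlas 𝓘(ℝ, E) ∞ M) :
    DifferentiableOn ℝ (e' ∘ e.symm) (e.target ∩ e.symm ⁻¹' e'.source) := by
  have hsmooth := (contMDiffOn_of_mem_maximalAtlas he').comp
    ((contMDiffOn_symm_of_mem_maximalAtlas he).mono
      (inter_subset_left (t := e.symm ⁻¹' e'.source))) fun y hy ↦ hy.2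
  exact (contMDiffOn_iff_contDiffOn.1 hsmooth).differentiableOn (by simp)

variable [FiniteDimensional ℝ E] [MeasurableSpace E] [BorelSpace E] (ν : Measure E)
  [ν.IsAddHaarMeasure]

lemma measure_image_chart_eq_zero (he : e ∈ IsManifold.maximalAtlas 𝓘(ℝ, E) ∞ M)
    (he' : e' ∈ IsManifold.maximalAtlas 𝓘(ℝ, E) ∞ M) {A : Set M} (hA : A ⊆ e.source)
    (hA' : A ⊆ e'.source) (hnull : ν (e '' A) = 0) : ν (e' '' A) = 0 := by
  have hsub : e '' A ⊆ e.target ∩ e.symm ⁻¹' e'.source := by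
    rintro _ ⟨x, hx, rfl⟩
    refine ⟨e.map_source (hA hx), ?_⟩
    rw [mem_preimage, e.left_inv (hA hx)]
    exact hA' hx
  have himage := addHaar_image_eq_zero_of_differentiableOn_of_addHaar_eq_zero ν
    ((differentiableOn_transition he he').mono hsub) hnull
  rwa [image_image, image_congr (g := e') fun x hx ↦ by
    rw [Function.comp, e.left_inv (hA hx)]] at himage

lemma measure_image_chart_eq_zero_iff_of_cover {ι : Type*} [Countable ι]
    {c : ι → OpenPartialHomeomorph M E} (hc : ∀ i, c i ∈ IsManifold.maximalAtlas 𝓘(ℝ, E) ∞ M)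
    (hcover : ∀ x, ∃ i, x ∈ (c i).source) (he : e ∈ IsManifold.maximalAtlas 𝓘(ℝ, E) ∞ M)
    {A : Set M} (hA : A ⊆ e.source) :
    (∀ i, ν (c i '' ((c i).source ∩ A)) = 0) ↔ ν (e '' A) = 0 := by
  refine ⟨fun h ↦ ?_, fun h i ↦ ?_⟩
  · have hsub : e '' A ⊆ ⋃ i, e '' ((c i).source ∩ A) := by
      rintro _ ⟨y, hy, rfl⟩
      obtain ⟨i, hi⟩ := hcover y
      exact mem_iUnion.2 ⟨i, mem_image_of_mem e ⟨hi, hy⟩⟩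
    exact measure_mono_null hsub (measure_iUnion_null fun i ↦ measure_image_chart_eq_zero ν (hc i)
      he inter_subset_left (inter_subset_right.trans hA) (h i))
  · exact measure_image_chart_eq_zero ν he (hc i) (inter_subset_right.trans hA) inter_subset_left
      (measure_mono_null (image_mono inter_subset_right) h)

lemma exists_measure_null_iff [IsManifold 𝓘(ℝ, E) ∞ M] [SecondCountableTopology M]
    [Nonempty M] [MeasurableSpace M] [BorelSpace M] :
    ∃ μ : Measure M, IsProbabilityMeasure μ ∧
      ∀ e ∈ IsManifold.maximalAtlas 𝓘(ℝ, E) ∞ M, ∀ A ⊆ e.source, MeasurableSet A →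
        (μ A = 0 ↔ ν (e '' A) = 0) := by
  obtain ⟨s, hs, hcover⟩ := TopologicalSpace.countable_cover_nhds
    (fun x : M ↦ chart_source_mem_nhds E x)
  have : Countable s := hs.to_subtype
  let κ : Measure M := Measure.sum fun x : s ↦
    (ν.restrict (chartAt E (x : M)).target).map (chartAt E (x : M)).symm
  have hκ : ∀ e ∈ IsManifold.maximalAtlas 𝓘(ℝ, E) ∞ M, ∀ A ⊆ e.source, MeasurableSet A →
      (κ A = 0 ↔ ν (e '' A) = 0) := by
    intro e he A hAe hA
    rw [Measure.sum_apply _ hA, ENNReal.tsum_eq_zero,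
      ← measure_image_chart_eq_zero_iff_of_cover (c := fun x : s ↦ chartAt E (x : M)) ν
        (fun x ↦ IsManifold.chart_mem_maximalAtlas _) (fun x ↦ ?_) he hAe]
    · exact forall_congr' fun x ↦ map_symm_restrict_target_eq_zero_iff ν _ hA
    · simpa using (hcover ▸ mem_univ x : x ∈ ⋃ y ∈ s, (chartAt E y).source)
  have : NeZero κ := ⟨fun hzero ↦ by
    obtain ⟨x⟩ := (inferInstance : Nonempty M)
    have hnull := (hκ _ (IsManifold.chart_mem_maximalAtlas x) _ subset_rfl
      (chartAt E x).open_source.measurableSet).1 (by rw [hzero]; rfl)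
    rw [(chartAt E x).image_source_eq_target] at hnull
    exact (chartAt E x).open_target.measure_ne_zero ν ⟨_, mem_chart_target E x⟩ hnull⟩
  refine ⟨κ.toFinite, inferInstance, fun e he A hAe hA ↦ ?_⟩
  rw [toFinite_apply_eq_zero_iff, hκ e he A hAe hA]

lemma measure_eq_zero_of_forall_add_smul_notMem {S : Set E} (hS : MeasurableSet S) {u : E}
    (h : ∀ y ∈ S, ∀ r : ℝ, 0 < r → y + r • u ∉ S) : ν S = 0 := by
  refine Measure.addHaar_eq_zero_of_disjoint_translates ν
    (u := fun k : ℕ ↦ (1 / ((k : ℝ) + 1)) • u)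
    (Metric.isBounded_range_of_tendsto _
      (tendsto_one_div_add_atTop_nhds_zero_nat.smul_const u))
    ((pairwise_disjoint_on _).2 fun k l hkl ↦ Set.disjoint_left.2 fun z hzk hzl ↦ ?_) hS
  rw [singleton_add, image_add_left, mem_preimage] at hzk hzl
  have hlt : 1 / ((l : ℝ) + 1) < 1 / ((k : ℝ) + 1) := Nat.one_div_lt_one_div hkl
  refine h _ hzk _ (sub_pos.2 hlt) ?_
  convert hzl using 1
  module

end NullSets

section Volume

variable {n : ℕ} {M : Type*} [TopologicalSpace M]
  [ChartedSpace (EuclideanSpace ℝ (Fin (n + 1))) M] [IsManifold (𝓡 (n + 1)) ∞ M]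
  [MeasurableSpace M] {μ : Measure M}

namespace Spacetime

variable {g : Spacetime n M}

lemma IsNormalizedVolume.isProbabilityMeasure (hμ : IsNormalizedVolume n μ) :
    IsProbabilityMeasure μ := ⟨hμ.1⟩

lemma volFuture_eq_volPast_reverse (g : Spacetime n M) (μ : Measure M) :
    g.volFuture μ = g.reverse.volPast μ := by
  ext p
  rw [volFuture, volPast, chronPast_reverse]

variable [BorelSpace M]

lemma exists_isNormalizedVolume [SecondCountableTopology M] [Nonempty M] :
    ∃ μ : Measure M, IsNormalizedVolume n μ := by
  obtain ⟨μ, hμ, hnull⟩ := exists_measure_null_iff (M := M)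
    (volume : Measure (EuclideanSpace ℝ (Fin (n + 1))))
  exact ⟨μ, measure_univ, hnull⟩

lemma IsNormalizedVolume.measure_pos (hμ : IsNormalizedVolume n μ) {U : Set M} (hU : IsOpen U)
    (hne : U.Nonempty) : 0 < μ U := by
  obtain ⟨x, hx⟩ := hne
  set e := chartAt (EuclideanSpace ℝ (Fin (n + 1))) x
  have hopen : IsOpen (e.source ∩ U) := e.open_source.inter hU
  refine pos_iff_ne_zero.2 fun hzero ↦ ?_
  have hnull := (hμ.2 e (IsManifold.chart_mem_maximalAtlas x) (e.source ∩ U) inter_subset_left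
    hopen.measurableSet).1 (measure_mono_null inter_subset_right hzero)
  exact (e.isOpen_image_of_subset_source hopen inter_subset_left).measure_ne_zero
    volume ⟨_, mem_image_of_mem e ⟨mem_chart_source _ x, hx⟩⟩ hnull

/-- In a chart, the lines in a fixed timelike direction are timelike curves, so that they meet an
achronal set at most once. -/
lemma IsNormalizedVolume.measure_eq_zero_of_achronal [SecondCountableTopology M]
    (hμ : IsNormalizedVolume n μ) {A : Set M} (hA : MeasurableSet A)
    (hachronal : ∀ p ∈ A, ∀ q ∈ A, q ∉ g.chronFuture {p} univ) : μ A = 0 := by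
  refine measure_null_of_locally_null _ fun x _ ↦ ?_
  have he := IsManifold.chart_mem_maximalAtlas (I := 𝓡 (n + 1)) (n := ∞) x
  have hxe := mem_chart_source (EuclideanSpace ℝ (Fin (n + 1))) x
  set e := chartAt (EuclideanSpace ℝ (Fin (n + 1))) x
  obtain ⟨u, hu, huu⟩ := g.isLorentz.exists_coordBilin_eq he (e.map_source hxe)
  obtain ⟨r, hr, hball, htimelike⟩ := g.isLorentz.exists_ball_timelike he hxe huu (by rwa [hu])
  set V := e.source ∩ e ⁻¹' Metric.ball (e x) r
  have hV : IsOpen V := e.isOpen_inter_preimage Metric.isOpen_ball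
  refine ⟨V ∩ A, inter_mem (mem_nhdsWithin_of_mem_nhds (hV.mem_nhds
    ⟨hxe, Metric.mem_ball_self hr⟩)) self_mem_nhdsWithin, ?_⟩
  have hVA : V ∩ A ⊆ e.source := inter_subset_left.trans inter_subset_left
  have hmeas : MeasurableSet (V ∩ A) := hV.measurableSet.inter hA
  rw [hμ.2 e he _ hVA hmeas]
  refine measure_eq_zero_of_forall_add_smul_notMem volume
    (measurableSet_image_of_subset_source hVA hmeas) (u := u) ?_
  rintro _ ⟨y, ⟨hyV, hyA⟩, rfl⟩ s hs ⟨z, ⟨hzV, hzA⟩, hz⟩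
  have hline := segment_timelikeVec_add_smul (m := g.metric) (o := g.orient) he hs
    (convex_ball (e x) r) hball hyV.2 (hz ▸ hzV.2)
    fun y hy ↦ htimelike y hy u (Metric.mem_ball_self hr)
  rw [← hz, e.left_inv hyV.1, e.left_inv hzV.1] at hline
  exact hachronal y hyA z hzA (mem_chronFuture.2 (.single hline))

lemma IsNormalizedVolume.measure_causalPast_diff_chronPast [T2Space M] [SecondCountableTopology M]
    (hμ : IsNormalizedVolume n μ) (hg : g.IsGloballyHyperbolic) (p : M) :
    μ (g.causalPast {p} univ \ g.chronPast {p} univ) = 0 :=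
  hμ.measure_eq_zero_of_achronal (g := g)
    ((hg.isClosed_causalPast p).measurableSet.diff (isOpen_chronPast p).measurableSet)
    fun _ hx _ hy hxy ↦ hx.2 (mem_chronPast.2
      (mem_chronFuture_of_chron_of_causal hxy (mem_causalPast.1 hy.1)))

lemma volPast_pos (hμ : IsNormalizedVolume n μ) (g : Spacetime n M) (p : M) :
    0 < g.volPast μ p := by
  have := hμ.isProbabilityMeasure
  obtain ⟨q, -, hq⟩ := exists_mem_chronPast (g := g) p univ_mem
  exact ENNReal.toReal_pos (hμ.measure_pos (isOpen_chronPast p) ⟨q, hq⟩).ne' (measure_ne_top _ _)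

lemma volFuture_pos (hμ : IsNormalizedVolume n μ) (g : Spacetime n M) (p : M) :
    0 < g.volFuture μ p := by
  rw [volFuture_eq_volPast_reverse]
  exact volPast_pos hμ _ p

variable [T2Space M]

lemma continuous_volPast [SecondCountableTopology M] (hμ : IsNormalizedVolume n μ)
    (hg : g.IsGloballyHyperbolic) : Continuous (g.volPast μ) := by
  have := hμ.isProbabilityMeasure
  refine continuous_iff_continuousAt.2 fun p ↦ ?_
  refine (ENNReal.tendsto_toReal (measure_ne_top _ _)).comp ?_
  refine tendsto_measure_of_ae_tendsto_indicator_of_isFiniteMeasure (𝓝 p)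
    (isOpen_chronPast p).measurableSet (fun q ↦ (isOpen_chronPast q).measurableSet) ?_
  filter_upwards [measure_eq_zero_iff_ae_notMem.1 (hμ.measure_causalPast_diff_chronPast hg p)]
    with x hx
  by_cases hxp : x ∈ g.chronPast {p} univ
  · filter_upwards [(isOpen_chronFuture (g := g) x).mem_nhds (mem_chronPast.1 hxp)] with q hq
    exact iff_of_true (mem_chronPast.2 hq) hxp
  · have hp : p ∈ (g.causalFuture {x} univ)ᶜ := fun h ↦ hx ⟨mem_causalPast.2 h, hxp⟩
    filter_upwards [(hg.isClosed_causalFuture x).isOpen_compl.mem_nhds hp] with q hq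
    exact iff_of_false (fun h ↦ hq (mem_causalFuture_of_mem_chronFuture (mem_chronPast.1 h))) hxp

lemma continuous_volFuture [SecondCountableTopology M] (hμ : IsNormalizedVolume n μ)
    (hg : g.IsGloballyHyperbolic) : Continuous (g.volFuture μ) := by
  rw [volFuture_eq_volPast_reverse]
  exact continuous_volPast hμ hg.reverse

lemma volPast_lt_volPast (hμ : IsNormalizedVolume n μ) (hg : g.IsGloballyHyperbolic) {p q : M}
    (h : q ∈ g.causalFuture {p} univ) (hne : p ≠ q) : g.volPast μ p < g.volPast μ q := by
  have := hμ.isProbabilityMeasure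
  have hsub : g.chronPast {p} univ ⊆ g.chronPast {q} univ := fun x hx ↦
    mem_chronPast.2 (mem_chronFuture_of_chron_of_causal (mem_chronPast.1 hx) h)
  have hcompl : IsOpen (g.causalPast {p} univ)ᶜ := (hg.isClosed_causalPast p).isOpen_compl
  set D := g.chronPast {q} univ ∩ (g.causalPast {p} univ)ᶜ
  have hDo : IsOpen D := (isOpen_chronPast q).inter hcompl
  have hq : q ∈ (g.causalPast {p} univ)ᶜ := fun hqp ↦
    hne (hg.eq_of_mem_causalFuture h (mem_causalPast.1 hqp))
  obtain ⟨x, hxp, hxq⟩ := exists_mem_chronPast (g := g) q (hcompl.mem_nhds hq)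
  have hDpos : 0 < μ.real D :=
    ENNReal.toReal_pos (hμ.measure_pos hDo ⟨x, hxq, hxp⟩).ne' (measure_ne_top _ _)
  have hdisj : Disjoint (g.chronPast {p} univ) D := Set.disjoint_left.2 fun x hx hxD ↦
    hxD.2 (mem_causalPast.2 (mem_causalFuture_of_mem_chronFuture (mem_chronPast.1 hx)))
  calc g.volPast μ p < μ.real (g.chronPast {p} univ) + μ.real D := lt_add_of_pos_right _ hDpos
    _ = μ.real (g.chronPast {p} univ ∪ D) := (measureReal_union hdisj hDo.measurableSet).symm
    _ ≤ g.volPast μ q := measureReal_mono (union_subset hsub inter_subset_left)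

lemma volFuture_lt_volFuture (hμ : IsNormalizedVolume n μ) (hg : g.IsGloballyHyperbolic) {p q : M}
    (h : q ∈ g.causalFuture {p} univ) (hne : p ≠ q) : g.volFuture μ q < g.volFuture μ p := by
  rw [volFuture_eq_volPast_reverse]
  refine volPast_lt_volPast hμ hg.reverse ?_ hne.symm
  rw [causalFuture_reverse]
  exact mem_causalPast.2 h

lemma continuous_volRatio [SecondCountableTopology M] (hμ : IsNormalizedVolume n μ)
    (hg : g.IsGloballyHyperbolic) : Continuous (g.volRatio μ) :=
  (continuous_volPast hμ hg).div (continuous_volFuture hμ hg) fun p ↦ (volFuture_pos hμ g p).ne'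

lemma volRatio_lt_volRatio (hμ : IsNormalizedVolume n μ) (hg : g.IsGloballyHyperbolic) {p q : M}
    (h : q ∈ g.causalFuture {p} univ) (hne : p ≠ q) : g.volRatio μ p < g.volRatio μ q :=
  div_lt_div₀ (volPast_lt_volPast hμ hg h hne) (volFuture_lt_volFuture hμ hg h hne).le
    (volPast_pos hμ g q).le (volFuture_pos hμ g q)

end Spacetime

end Volume

/-! ### Time functions and the compactness of the space of curves -/

section TimeFunctions

variable {n : ℕ} {M : Type*} [TopologicalSpace M]
  [ChartedSpace (EuclideanSpace ℝ (Fin (n + 1))) M] [IsManifold (𝓡 (n + 1)) ∞ M]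

namespace Spacetime

variable {g : Spacetime n M} {p q : M}

namespace CurveSpace

lemma exists_points_eq_image (c : g.CurveSpace p q) : ∃ γ : ℝ → M, g.IsCausalCurve (Icc 0 1) γ ∧
    γ 0 = p ∧ γ 1 = q ∧ points g c = γ '' Icc 0 1 := by
  obtain ⟨γ, rfl⟩ := Quotient.exists_rep c
  refine ⟨γ.1.extend, γ.2, γ.1.extend_zero, γ.1.extend_one, ?_⟩
  change range γ.1 = _
  ext x
  constructor
  · rintro ⟨u, rfl⟩
    exact ⟨u, u.2, γ.1.extend_apply u.2⟩
  · rintro ⟨u, hu, rfl⟩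
    exact ⟨⟨u, hu⟩, (γ.1.extend_apply hu).symm⟩

lemma points_subset (c : g.CurveSpace p q) :
    points g c ⊆ g.causalFuture {p} univ ∩ g.causalPast {q} univ := by
  obtain ⟨γ, hγ, rfl, rfl, hpoints⟩ := exists_points_eq_image c
  rw [hpoints]
  rintro _ ⟨t, ht, rfl⟩
  exact ⟨hγ.mem_causalFuture (left_mem_Icc.2 zero_le_one) ht ht.1,
    mem_causalPast.2 (hγ.mem_causalFuture ht (right_mem_Icc.2 zero_le_one) ht.2)⟩

lemma le_nhds_of_forall_tendsto (𝓕 : Ultrafilter (g.CurveSpace p q)) (c₀ : g.CurveSpace p q)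
    (h : ∀ y : g.CurveSpace p q → M, (∀ᶠ c in (𝓕 : Filter _), y c ∈ points g c) →
      ∃ z ∈ points g c₀, Tendsto y 𝓕 (𝓝 z)) : (𝓕 : Filter (g.CurveSpace p q)) ≤ 𝓝 c₀ := by
  rw [TopologicalSpace.nhds_generateFrom]
  refine le_iInf₂ fun s ⟨hc₀, W, hW, hsW⟩ ↦ le_principal_iff.2 ?_
  subst hsW
  by_contra hmem
  have hnot : ∀ᶠ c in (𝓕 : Filter (g.CurveSpace p q)), ¬ points g c ⊆ W :=
    Ultrafilter.eventually_not.2 hmem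
  have hex : ∀ c : g.CurveSpace p q, ∃ y, ¬ points g c ⊆ W → y ∈ points g c ∧ y ∉ W := fun c ↦ by
    by_cases hc : points g c ⊆ W
    · exact ⟨p, fun hc' ↦ (hc' hc).elim⟩
    · obtain ⟨y, hy⟩ := not_subset.1 hc
      exact ⟨y, fun _ ↦ hy⟩
  choose y hy using hex
  obtain ⟨z, hz, hyz⟩ := h y (hnot.mono fun c hc ↦ (hy c hc).1)
  exact hW.isClosed_compl.mem_of_tendsto hyz (hnot.mono fun c hc ↦ (hy c hc).2) (hc₀ hz)

lemma exists_tendsto_of_mem_points (hg : g.IsGloballyHyperbolic)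
    (𝓕 : Ultrafilter (g.CurveSpace p q)) {σ : g.CurveSpace p q → M}
    (hσ : ∀ᶠ c in (𝓕 : Filter _), σ c ∈ points g c) :
    ∃ x ∈ g.causalFuture {p} univ ∩ g.causalPast {q} univ, Tendsto σ 𝓕 (𝓝 x) :=
  (hg.2 p q).ultrafilter_le_nhds (𝓕.map σ)
    (le_principal_iff.2 (hσ.mono fun c hc ↦ points_subset c hc : _ ∈ map σ 𝓕))

end CurveSpace

/-- A continuous function which is strictly increasing along the causal relation. -/
structure IsTimeFunction (g : Spacetime n M) (f : M → ℝ) : Prop where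
  continuous : Continuous f
  lt : ∀ {x y : M}, y ∈ g.causalFuture {x} univ → x ≠ y → f x < f y

lemma IsNormalizedVolume.isTimeFunction [T2Space M] [SecondCountableTopology M]
    [MeasurableSpace M] [BorelSpace M] {μ : Measure M} (hμ : IsNormalizedVolume n μ)
    (hg : g.IsGloballyHyperbolic) : g.IsTimeFunction (g.volRatio μ) :=
  ⟨continuous_volRatio hμ hg, volRatio_lt_volRatio hμ hg⟩

namespace IsTimeFunction

variable {f : M → ℝ} (hf : g.IsTimeFunction f)

include hf

lemma le {x y : M} (h : y ∈ g.causalFuture {x} univ) : f x ≤ f y := by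
  rcases eq_or_ne x y with rfl | hne
  · rfl
  · exact (hf.lt h hne).le

lemma eq_of_apply_eq {x y : M} (h : y ∈ g.causalFuture {x} univ) (hxy : f x = f y) : x = y :=
  by_contra fun hne ↦ (hf.lt h hne).ne hxy

lemma strictMonoOn {F : Set ℝ} {γ : ℝ → M} (h : g.IsCausalCurve F γ) :
    StrictMonoOn (f ∘ γ) F := by
  obtain ⟨hF, -, -, hloc⟩ := h
  intro a ha b hb hab
  refine rel_of_locallyRel (R := fun s t ↦ f (γ s) < f (γ t)) hF
    (fun _ _ _ ↦ lt_trans) (fun t ht ↦ ?_) ha hb hab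
  obtain ⟨G, hG, hR⟩ := hloc t ht univ isOpen_univ (mem_univ _)
  refine ⟨G, hG, fun s₁ hs₁ s₂ hs₂ hlt ↦ ?_⟩
  obtain ⟨hne, hmem⟩ := hR s₁ hs₁ s₂ hs₂ hlt
  exact hf.lt hmem hne

lemma lt_of_mem_chronFuture {x y : M} (h : y ∈ g.chronFuture {x} univ) : f x < f y := by
  obtain ⟨b, hb, γ, hγ, rfl, rfl⟩ := exists_isCausalCurve (Relation.TransGen.mono
    (fun _ _ (h : g.TimelikeSegment univ _ _) ↦ h.causal) _ _ (mem_chronFuture.1 h))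
  exact hf.strictMonoOn hγ (left_mem_Icc.2 hb.le) (right_mem_Icc.2 hb.le) hb

lemma lt_of_curveSpace (c : g.CurveSpace p q) : f p < f q := by
  obtain ⟨γ, hγ, rfl, rfl, -⟩ := c.exists_points_eq_image
  exact hf.strictMonoOn hγ (left_mem_Icc.2 zero_le_one) (right_mem_Icc.2 zero_le_one) zero_lt_one

lemma exists_mem_points (c : g.CurveSpace p q) {t : ℝ} (ht : t ∈ Icc (f p) (f q)) :
    ∃ x ∈ CurveSpace.points g c, f x = t := by
  obtain ⟨γ, hγ, rfl, rfl, hpoints⟩ := c.exists_points_eq_image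
  obtain ⟨s, hs, hst⟩ := intermediate_value_Icc zero_le_one
    (hf.continuous.comp_continuousOn hγ.2.2.1) ht
  exact ⟨γ s, hpoints ▸ mem_image_of_mem γ hs, hst⟩

lemma mem_causalFuture_of_mem_points (c : g.CurveSpace p q) {x y : M}
    (hx : x ∈ CurveSpace.points g c) (hy : y ∈ CurveSpace.points g c) (hxy : f x ≤ f y) :
    y ∈ g.causalFuture {x} univ := by
  obtain ⟨γ, hγ, rfl, rfl, hpoints⟩ := c.exists_points_eq_image
  rw [hpoints] at hx hy
  obtain ⟨s, hs, rfl⟩ := hx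
  obtain ⟨t, ht, rfl⟩ := hy
  exact hγ.mem_causalFuture hs ht ((hf.strictMonoOn hγ).le_iff_le hs ht |>.1 hxy)

variable [T2Space M] (hg : g.IsGloballyHyperbolic)

include hg

lemma eq_of_tendsto {ι : Type*} {l : Filter ι} [l.NeBot] {a b : ι → M} {x y : M}
    (ha : Tendsto a l (𝓝 x)) (hb : Tendsto b l (𝓝 y))
    (hab : ∀ᶠ i in l, b i ∈ g.causalFuture {a i} univ ∨ a i ∈ g.causalFuture {b i} univ)
    (hxy : f x = f y) : x = y := by
  rcases frequently_or_distrib.1 hab.frequently with h | h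
  · exact hf.eq_of_apply_eq
      (hg.isClosed_causalRel.mem_of_frequently_of_tendsto h (ha.prodMk_nhds hb)) hxy
  · exact (hf.eq_of_apply_eq
      (hg.isClosed_causalRel.mem_of_frequently_of_tendsto h (hb.prodMk_nhds ha)) hxy.symm).symm

lemma continuousOn_of_mem_causalFuture {K : Set M} (hK : IsCompact K) {I : Set ℝ} {Γ : ℝ → M}
    (hΓ : MapsTo Γ I K) (hfΓ : ∀ t ∈ I, f (Γ t) = t)
    (hle : ∀ s ∈ I, ∀ t ∈ I, s ≤ t → Γ t ∈ g.causalFuture {Γ s} univ) : ContinuousOn Γ I := by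
  intro t ht
  rw [ContinuousWithinAt, tendsto_iff_ultrafilter]
  intro 𝓖 h𝓖
  have hI : ∀ᶠ s in (𝓖 : Filter ℝ), s ∈ I := h𝓖 self_mem_nhdsWithin
  obtain ⟨y, -, hy⟩ : ∃ y ∈ K, Tendsto Γ 𝓖 (𝓝 y) := hK.ultrafilter_le_nhds (𝓖.map Γ)
    (le_principal_iff.2 (show K ∈ map Γ 𝓖 from hI.mono fun s hs ↦ hΓ hs))
  have hlim : Tendsto (fun s ↦ f (Γ s)) 𝓖 (𝓝 t) :=
    Tendsto.congr' (hI.mono fun s hs ↦ (hfΓ s hs).symm) (h𝓖.trans nhdsWithin_le_nhds)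
  have hfy : f y = f (Γ t) :=
    (tendsto_nhds_unique ((hf.continuous.tendsto y).comp hy) hlim).trans (hfΓ t ht).symm
  have hyt : y = Γ t := hf.eq_of_tendsto hg hy (tendsto_const_nhds (x := Γ t))
    (hI.mono fun s hs ↦ (le_total s t).imp (hle s hs t ht) (hle t ht s hs)) hfy
  rwa [← hyt]

lemma exists_mapsTo_points (hpq : f p < f q) {Γ : ℝ → M}
    (hΓ : MapsTo Γ (Icc (f p) (f q)) (g.causalFuture {p} univ ∩ g.causalPast {q} univ))
    (hfΓ : ∀ t ∈ Icc (f p) (f q), f (Γ t) = t)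
    (hle : ∀ s ∈ Icc (f p) (f q), ∀ t ∈ Icc (f p) (f q), s ≤ t →
      Γ t ∈ g.causalFuture {Γ s} univ) :
    ∃ c : g.CurveSpace p q, MapsTo Γ (Icc (f p) (f q)) (CurveSpace.points g c) := by
  have hp : f p ∈ Icc (f p) (f q) := left_mem_Icc.2 hpq.le
  have hq : f q ∈ Icc (f p) (f q) := right_mem_Icc.2 hpq.le
  have hpos : 0 < f q - f p := sub_pos.2 hpq
  have hΓp : Γ (f p) = p := (hf.eq_of_apply_eq (hΓ hp).1 (hfΓ _ hp).symm).symm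
  have hΓq : Γ (f q) = q := hf.eq_of_apply_eq (mem_causalPast.1 (hΓ hq).2) (hfΓ _ hq)
  have hmem : ∀ u ∈ Icc (0 : ℝ) 1, f p + u * (f q - f p) ∈ Icc (f p) (f q) := fun u hu ↦
    ⟨by nlinarith [hu.1], by nlinarith [hu.2]⟩
  let γ : Path p q :=
    { toFun := fun u ↦ Γ (f p + u * (f q - f p))
      continuous_toFun := (hf.continuousOn_of_mem_causalFuture hg (hg.2 p q) hΓ hfΓ hle
        ).comp_continuous (by fun_prop) fun u ↦ hmem u u.2
      source' := by simpa using hΓp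
      target' := by simpa using hΓq }
  have hextend : ∀ u ∈ Icc (0 : ℝ) 1, γ.extend u = Γ (f p + u * (f q - f p)) :=
    fun u hu ↦ γ.extend_apply hu
  have hγ : g.IsCausalCurve (Icc 0 1) γ.extend := by
    refine isCausalCurve_of_forall_causalFuture hg.1 ordConnected_Icc
      (nontrivial_Icc_of_lt one_pos) γ.continuous_extend.continuousOn fun s hs t ht hst ↦ ?_
    rw [hextend s hs, hextend t ht]
    have hlt : f p + s * (f q - f p) < f p + t * (f q - f p) := by gcongr
    refine ⟨fun heq ↦ hlt.ne ?_, hle _ (hmem s hs) _ (hmem t ht) hlt.le⟩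
    rw [← hfΓ _ (hmem s hs), heq, hfΓ _ (hmem t ht)]
  refine ⟨Quotient.mk (g.reparam p q) ⟨γ, hγ⟩, fun t ht ↦ ?_⟩
  change Γ t ∈ range γ
  refine ⟨⟨(t - f p) / (f q - f p), div_nonneg (sub_nonneg.2 ht.1) hpos.le,
    (div_le_one hpos).2 (sub_le_sub_right ht.2 _)⟩, ?_⟩
  change Γ (f p + (t - f p) / (f q - f p) * (f q - f p)) = Γ t
  rw [div_mul_cancel₀ _ hpos.ne', add_sub_cancel]

lemma exists_forall_exists_tendsto (𝓕 : Ultrafilter (g.CurveSpace p q)) :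
    ∃ c₀ : g.CurveSpace p q, ∀ t ∈ Icc (f p) (f q), ∃ x ∈ CurveSpace.points g c₀,
      ∃ σ : g.CurveSpace p q → M, (∀ c, σ c ∈ CurveSpace.points g c ∧ f (σ c) = t) ∧
        Tendsto σ 𝓕 (𝓝 x) := by
  obtain ⟨c₁, -⟩ := 𝓕.nonempty_of_mem univ_mem
  have hex : ∀ t ∈ Icc (f p) (f q), ∃ x ∈ g.causalFuture {p} univ ∩ g.causalPast {q} univ,
      ∃ σ : g.CurveSpace p q → M, (∀ c, σ c ∈ CurveSpace.points g c ∧ f (σ c) = t) ∧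
        Tendsto σ 𝓕 (𝓝 x) := by
    intro t ht
    choose σ hσ using fun c : g.CurveSpace p q ↦ hf.exists_mem_points c ht
    obtain ⟨x, hx, hlim⟩ :=
      CurveSpace.exists_tendsto_of_mem_points hg 𝓕 (.of_forall fun c ↦ (hσ c).1)
    exact ⟨x, hx, σ, hσ, hlim⟩
  have : Nonempty M := ⟨p⟩
  have : Nonempty (g.CurveSpace p q) := ⟨c₁⟩
  choose! Γ hΓ σ hσ hlim using hex
  have hfΓ : ∀ t ∈ Icc (f p) (f q), f (Γ t) = t := fun t ht ↦
    tendsto_nhds_unique ((hf.continuous.tendsto _).comp (hlim t ht))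
      (tendsto_const_nhds.congr fun c ↦ (hσ t ht c).2.symm)
  have hle : ∀ s ∈ Icc (f p) (f q), ∀ t ∈ Icc (f p) (f q), s ≤ t →
      Γ t ∈ g.causalFuture {Γ s} univ := fun s hs t ht hst ↦
    hg.isClosed_causalRel.mem_of_tendsto ((hlim s hs).prodMk_nhds (hlim t ht))
      (.of_forall fun c ↦ hf.mem_causalFuture_of_mem_points c (hσ s hs c).1 (hσ t ht c).1
        (by rwa [(hσ s hs c).2, (hσ t ht c).2]))
  obtain ⟨c₀, hc₀⟩ := hf.exists_mapsTo_points hg (hf.lt_of_curveSpace c₁) hΓ hfΓ hle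
  exact ⟨c₀, fun t ht ↦ ⟨Γ t, hc₀ ht, σ t, hσ t ht, hlim t ht⟩⟩

lemma compactSpace_curveSpace (p q : M) : CompactSpace (g.CurveSpace p q) := by
  refine ⟨isCompact_iff_ultrafilter_le_nhds.2 fun 𝓕 _ ↦ ?_⟩
  obtain ⟨c₀, hc₀⟩ := hf.exists_forall_exists_tendsto hg 𝓕
  refine ⟨c₀, mem_univ _, CurveSpace.le_nhds_of_forall_tendsto 𝓕 c₀ fun y hy ↦ ?_⟩
  obtain ⟨z, hz, hyz⟩ := CurveSpace.exists_tendsto_of_mem_points hg 𝓕 hy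
  obtain ⟨x, hx, σ, hσ, hσx⟩ := hc₀ (f z) ⟨hf.le hz.1, hf.le (mem_causalPast.1 hz.2)⟩
  have hfx : f x = f z := tendsto_nhds_unique ((hf.continuous.tendsto x).comp hσx)
    (tendsto_const_nhds.congr fun c ↦ (hσ c).2.symm)
  have hxz : x = z := hf.eq_of_tendsto hg hσx hyz (hy.mono fun c hc ↦
    (le_total (f (σ c)) (f (y c))).imp (hf.mem_causalFuture_of_mem_points c (hσ c).1 hc)
      (hf.mem_causalFuture_of_mem_points c hc (hσ c).1)) hfx
  exact ⟨z, hxz ▸ hx, hyz⟩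

end IsTimeFunction

end Spacetime

end TimeFunctions

/-! ### Level sets of time functions -/

section ChartTimelike

variable {E : Type*} [NormedAddCommGroup E] [NormedSpace ℝ E]
  {M : Type*} [TopologicalSpace M] [ChartedSpace E M] [IsManifold 𝓘(ℝ, E) ∞ M]

lemma transHomeomorph_mem_maximalAtlas {e : OpenPartialHomeomorph M E}
    (he : e ∈ IsManifold.maximalAtlas 𝓘(ℝ, E) ∞ M) (A : E ≃L[ℝ] E) :
    e.transHomeomorph A.toHomeomorph ∈ IsManifold.maximalAtlas 𝓘(ℝ, E) ∞ M := by
  refine OpenPartialHomeomorph.mem_maximalAtlas_of_contMDiffOn _ ?_ ?_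
  · exact A.contDiff.contMDiff.comp_contMDiffOn (contMDiffOn_of_mem_maximalAtlas he)
  · exact (contMDiffOn_symm_of_mem_maximalAtlas he).comp A.symm.contDiff.contMDiff.contMDiffOn
      fun y hy ↦ hy

variable {m : ∀ x : M, TangentSpace 𝓘(ℝ, E) x →L[ℝ] TangentSpace 𝓘(ℝ, E) x →L[ℝ] ℝ}
  {o : ∀ x : M, TangentSpace 𝓘(ℝ, E) x} [FiniteDimensional ℝ E]

lemma IsLorentz.exists_chart_timelike (h : IsLorentz m o) (p : M) {b : E} (hb : b ≠ 0) :
    ∃ e ∈ IsManifold.maximalAtlas 𝓘(ℝ, E) ∞ M, p ∈ e.source ∧ ∃ W ∈ 𝓝 (e p), W ⊆ e.target ∧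
      ∃ C ∈ 𝓝 b, ∀ x ∈ W, ∀ w ∈ C, ∀ s : ℝ, 0 < s → x + s • w ∈ W →
        Segment (TimelikeVec m o) univ (e.symm x) (e.symm (x + s • w)) := by
  have he := IsManifold.chart_mem_maximalAtlas (I := 𝓘(ℝ, E)) (n := ∞) p
  have hp := mem_chart_source E p
  set e := chartAt E p
  obtain ⟨u, hu, huu⟩ := h.exists_coordBilin_eq he (e.map_source hp)
  obtain ⟨r, hr, hrt, htimelike⟩ := h.exists_ball_timelike he hp huu (by rwa [hu])
  have hu0 : u ≠ 0 := by
    rintro rfl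
    simp at huu
  -- A linear change of coordinates moves the timelike direction `u` to the prescribed one.
  obtain ⟨A, hA⟩ := SeparatingDual.exists_continuousLinearEquiv_apply_eq (R := ℝ) hu0 hb
  have hW : A.symm ⁻¹' Metric.ball (e p) r ∈ 𝓝 (A (e p)) :=
    A.symm.continuous.continuousAt.preimage_mem_nhds
      (by rw [A.symm_apply_apply]; exact Metric.ball_mem_nhds _ hr)
  have hC : A.symm ⁻¹' Metric.ball u r ∈ 𝓝 b :=
    A.symm.continuous.continuousAt.preimage_mem_nhds
      (by rw [← hA, A.symm_apply_apply]; exact Metric.ball_mem_nhds _ hr)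
  refine ⟨_, transHomeomorph_mem_maximalAtlas he A, hp, _, hW, fun x hx ↦ hrt hx, _, hC,
    fun x hx w hw s hs hxw ↦ ?_⟩
  have hmap : A.symm (x + s • w) = A.symm x + s • A.symm w := by rw [map_add, map_smul]
  have hsegment := segment_timelikeVec_add_smul (m := m) (o := o) he hs (convex_ball (e p) r) hrt
    hx (hmap ▸ hxw) fun y hy ↦ htimelike y hy _ hw
  rwa [← hmap] at hsegment

end ChartTimelike

section ConeMonotone

variable {n : ℕ}

/-- The box around `z` with half-width `ε` in the first coordinate, which plays the role of time,
and half-width `η` in the other coordinates. -/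
def box (z : EuclideanSpace ℝ (Fin (n + 1))) (ε η : ℝ) : Set (EuclideanSpace ℝ (Fin (n + 1))) :=
  {x | |x 0 - z 0| < ε ∧ ∀ i : Fin n, |x i.succ - z i.succ| < η}

/-- `φ` is strictly increasing on `B` in the directions of the cone of slope `κ` (in the supremum
norm) around the first coordinate axis. -/
def ConeStrictMonoOn (κ : ℝ) (φ : EuclideanSpace ℝ (Fin (n + 1)) → ℝ)
    (B : Set (EuclideanSpace ℝ (Fin (n + 1)))) : Prop :=
  ∀ x ∈ B, ∀ y ∈ B, x 0 < y 0 → (∀ i : Fin n, |y i.succ - x i.succ| ≤ κ * (y 0 - x 0)) → φ x < φ y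

/-- The point with first coordinate `t` and remaining coordinates `v`. -/
def consPoint (t : ℝ) (v : Fin n → ℝ) : EuclideanSpace ℝ (Fin (n + 1)) :=
  WithLp.toLp 2 (Fin.cons t v)

lemma consPoint_zero_succ (x : EuclideanSpace ℝ (Fin (n + 1))) :
    consPoint (x 0) (fun i ↦ x i.succ) = x := by
  ext j
  exact Fin.cases rfl (fun _ ↦ rfl) j

lemma continuous_consPoint (v : Fin n → ℝ) : Continuous fun t ↦ consPoint t v :=
  (PiLp.continuous_toLp 2 _).comp
    (continuous_pi fun j ↦ Fin.cases continuous_id (fun _ ↦ continuous_const) j)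

variable {z : EuclideanSpace ℝ (Fin (n + 1))} {ε η κ : ℝ}

lemma mem_box_self (hε : 0 < ε) (hη : 0 < η) : z ∈ box z ε η :=
  ⟨by simpa using hε, fun i ↦ by simpa using hη⟩

lemma box_subset_box {η' : ℝ} (h : η ≤ η') : box z ε η ⊆ box z ε η' :=
  fun _ hx ↦ ⟨hx.1, fun i ↦ (hx.2 i).trans_le h⟩

lemma isOpen_box : IsOpen (box z ε η) := by
  simp only [box, Set.ofPred_and, Set.ofPred_forall]
  exact (isOpen_lt (by fun_prop) continuous_const).inter
    (isOpen_iInter_of_finite fun i ↦ isOpen_lt (by fun_prop) continuous_const)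

lemma exists_box_subset {W : Set (EuclideanSpace ℝ (Fin (n + 1)))} (hW : W ∈ 𝓝 z) :
    ∃ ε > 0, box z ε ε ⊆ W := by
  have hcont : ContinuousAt (WithLp.toLp 2) (WithLp.ofLp z) :=
    (PiLp.continuous_toLp 2 _).continuousAt
  obtain ⟨ε, hε, hball⟩ := Metric.mem_nhds_iff.1 (hcont.preimage_mem_nhds (t := W) hW)
  refine ⟨ε, hε, fun y hy ↦ hball (a := WithLp.ofLp y) ?_⟩
  rw [Metric.mem_ball, dist_pi_lt_iff hε]
  exact Fin.cases hy.1 hy.2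

namespace ConeStrictMonoOn

variable {φ : EuclideanSpace ℝ (Fin (n + 1)) → ℝ} {B : Set (EuclideanSpace ℝ (Fin (n + 1)))}

lemma sub_le_of_eq (hφ : ConeStrictMonoOn κ φ B) (hκ : 0 < κ)
    {x y : EuclideanSpace ℝ (Fin (n + 1))} (hx : x ∈ B) (hy : y ∈ B) (hxy : φ x = φ y) :
    y 0 - x 0 ≤ κ⁻¹ * dist (fun i : Fin n ↦ y i.succ) (fun i ↦ x i.succ) := by
  by_contra! hlt
  refine (hφ x hx y hy (sub_pos.1 (lt_of_le_of_lt (by positivity) hlt)) fun i ↦ ?_).ne hxy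
  rw [inv_mul_lt_iff₀ hκ] at hlt
  exact (dist_le_pi_dist (fun i : Fin n ↦ y i.succ) (fun i ↦ x i.succ) i).trans hlt.le

lemma exists_consPoint_eq (hφ : ConeStrictMonoOn κ φ (box z ε η))
    (hcont : ContinuousOn φ (box z ε η)) (hε : 0 < ε) (hη : 0 < η) (hηκ : η ≤ κ * (ε / 2))
    {v : Fin n → ℝ} (hv : ∀ i, |v i - z i.succ| < η) :
    ∃ t, consPoint t v ∈ box z ε η ∧ φ (consPoint t v) = φ z := by
  have hmem : ∀ t ∈ Icc (z 0 - ε / 2) (z 0 + ε / 2), consPoint t v ∈ box z ε η := fun t ht ↦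
    ⟨abs_lt.2 ⟨by change -ε < t - z 0; linarith [ht.1], by change t - z 0 < ε; linarith [ht.2]⟩, hv⟩
  have hab : z 0 - ε / 2 ≤ z 0 + ε / 2 := by linarith
  have hz := mem_box_self (z := z) hε hη
  have hbelow : φ (consPoint (z 0 - ε / 2) v) < φ z := by
    refine hφ _ (hmem _ (left_mem_Icc.2 hab)) _ hz (show z 0 - ε / 2 < z 0 by linarith) fun i ↦ ?_
    change |z i.succ - v i| ≤ κ * (z 0 - (z 0 - ε / 2))
    rw [abs_sub_comm, sub_sub_cancel]
    exact (hv i).le.trans hηκ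
  have habove : φ z < φ (consPoint (z 0 + ε / 2) v) := by
    refine hφ _ hz _ (hmem _ (right_mem_Icc.2 hab)) (show z 0 < z 0 + ε / 2 by linarith) fun i ↦ ?_
    change |v i - z i.succ| ≤ κ * (z 0 + ε / 2 - z 0)
    rw [add_sub_cancel_left]
    exact (hv i).le.trans hηκ
  obtain ⟨t, ht, heq⟩ := intermediate_value_Icc hab
    (hcont.comp (continuous_consPoint v).continuousOn hmem) ⟨hbelow.le, habove.le⟩
  exact ⟨t, hmem t ht, heq⟩

lemma exists_lipschitzWith_graph (hφ : ConeStrictMonoOn κ φ (box z ε η))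
    (hcont : ContinuousOn φ (box z ε η)) (hε : 0 < ε) (hη : 0 < η) (hκ : 0 < κ)
    (hηκ : η ≤ κ * (ε / 2)) :
    ∃ (K : NNReal) (h : (Fin n → ℝ) → ℝ), LipschitzWith K h ∧
      ∀ x ∈ box z ε η, φ x = φ z ↔ x 0 = h fun i ↦ x i.succ := by
  choose! h₀ hbox hlevel using fun v (hv : v ∈ {v : Fin n → ℝ | ∀ i, |v i - z i.succ| < η}) ↦
    hφ.exists_consPoint_eq hcont hε hη hηκ hv
  have hlip : LipschitzOnWith ⟨κ⁻¹, (inv_pos.2 hκ).le⟩ h₀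
      {v : Fin n → ℝ | ∀ i, |v i - z i.succ| < η} := by
    refine LipschitzOnWith.of_le_add_mul _ fun v hv w hw ↦ sub_le_iff_le_add'.1 ?_
    exact hφ.sub_le_of_eq hκ (hbox w hw) (hbox v hv) ((hlevel w hw).trans (hlevel v hv).symm)
  obtain ⟨h, hh, heq⟩ := hlip.extend_real
  refine ⟨_, h, hh, fun x hx ↦ ?_⟩
  rw [← heq hx.2]
  constructor
  · intro hxz
    have hle : ∀ {a b : ℝ}, a - b ≤ κ⁻¹ * dist (fun i : Fin n ↦ x i.succ) (fun i ↦ x i.succ) →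
        a ≤ b := fun hab ↦ by rwa [dist_self, mul_zero, sub_nonpos] at hab
    have hx' := hxz.trans (hlevel _ hx.2).symm
    exact le_antisymm (hle (hφ.sub_le_of_eq hκ (hbox _ hx.2) hx hx'.symm))
      (hle (hφ.sub_le_of_eq hκ hx (hbox _ hx.2) hx'))
  · intro hx0
    rw [← hlevel _ hx.2, ← hx0, consPoint_zero_succ]

end ConeStrictMonoOn

end ConeMonotone

section Level

variable {n : ℕ} {M : Type*} [TopologicalSpace M]
  [ChartedSpace (EuclideanSpace ℝ (Fin (n + 1))) M] [IsManifold (𝓡 (n + 1)) ∞ M]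

namespace Spacetime

variable {g : Spacetime n M} {f : M → ℝ}

lemma IsTimeFunction.exists_chart_coneStrictMonoOn (hf : g.IsTimeFunction f) (p : M) :
    ∃ e ∈ IsManifold.maximalAtlas (𝓡 (n + 1)) ∞ M, p ∈ e.source ∧ ∃ ε > 0, ∃ κ > 0,
      box (e p) ε ε ⊆ e.target ∧ ConeStrictMonoOn κ (f ∘ e.symm) (box (e p) ε ε) := by
  obtain ⟨e, he, hp, W, hW, hWt, C, hC, htimelike⟩ := g.isLorentz.exists_chart_timelike p
    (b := EuclideanSpace.single (0 : Fin (n + 1)) (1 : ℝ)) (by simp)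
  obtain ⟨ε, hε, hεW⟩ := exists_box_subset hW
  obtain ⟨δ, hδ, hδC⟩ := exists_box_subset hC
  refine ⟨e, he, hp, ε, hε, δ / 2, half_pos hδ, hεW.trans hWt, fun x hx y hy hxy hcone ↦
    hf.lt_of_mem_chronFuture (mem_chronFuture.2 (.single ?_))⟩
  have hs : 0 < y 0 - x 0 := sub_pos.2 hxy
  have hsum : x + (y 0 - x 0) • (y 0 - x 0)⁻¹ • (y - x) = y := by
    rw [smul_inv_smul₀ hs.ne', add_sub_cancel]
  have hdirection : (y 0 - x 0)⁻¹ • (y - x) ∈ C := by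
    refine hδC ⟨by simpa [inv_mul_cancel₀ hs.ne'] using hδ, fun i ↦ ?_⟩
    have hslope : |(y 0 - x 0)⁻¹ * (y i.succ - x i.succ)| ≤ δ / 2 := by
      rw [abs_mul, abs_of_pos (inv_pos.2 hs), inv_mul_le_iff₀ hs, mul_comm]
      exact hcone i
    simpa using hslope.trans_lt (half_lt_self hδ)
  have hsegment := htimelike x (hεW hx) _ hdirection _ hs (hsum.symm ▸ hεW hy)
  rwa [hsum] at hsegment

lemma IsTimeFunction.isLipschitzHypersurface (hf : g.IsTimeFunction f) (c : ℝ) :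
    IsLipschitzHypersurface n {x : M | f x = c} := by
  rintro p rfl
  obtain ⟨e, he, hp, ε, hε, κ, hκ, htarget, hcone⟩ := hf.exists_chart_coneStrictMonoOn p
  set η := min ε (κ * (ε / 2))
  have hη : 0 < η := lt_min hε (by positivity)
  have hsub : box (e p) ε η ⊆ box (e p) ε ε := box_subset_box (min_le_left _ _)
  obtain ⟨K, h, hh, hgraph⟩ := ConeStrictMonoOn.exists_lipschitzWith_graph
    (fun x hx y hy ↦ hcone x (hsub hx) y (hsub hy))
    (hf.continuous.comp_continuousOn (e.continuousOn_symm.mono (hsub.trans htarget))) hε hη hκ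
    (min_le_right _ _)
  have hopen := e.isOpen_inter_preimage (isOpen_box (z := e p) (ε := ε) (η := η))
  refine ⟨e.restr (e.source ∩ e ⁻¹' box (e p) ε η), restr_mem_maximalAtlas _ he hopen, ?_, K, h, hh,
    fun x hx ↦ ?_⟩
  · rw [e.restr_source' _ hopen]
    exact ⟨hp, hp, mem_box_self hε hη⟩
  · rw [e.restr_source' _ hopen] at hx
    simpa [e.left_inv hx.1, e.left_inv hp] using hgraph (e x) hx.2.2

end Spacetime

end Level

/-! ### Cauchy surfaces -/

section CauchySurface

variable {n : ℕ} {M : Type*} [TopologicalSpace M]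
  [ChartedSpace (EuclideanSpace ℝ (Fin (n + 1))) M] [IsManifold (𝓡 (n + 1)) ∞ M]

namespace Spacetime

variable {g : Spacetime n M}

lemma IsFutureEndpoint.isPastEndpoint_of_neg {F : Set ℝ} {γ : ℝ → M} {p : M}
    (h : IsFutureEndpoint (Neg.neg ⁻¹' F) (fun t ↦ γ (-t)) p) : IsPastEndpoint F γ p := by
  intro V hV
  obtain ⟨t, ht, htV⟩ := h V hV
  refine ⟨-t, ht, fun s hs hst ↦ ?_⟩
  simpa using htV (-s) (by simpa using hs) (le_neg_of_le_neg hst)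

lemma volRatio_reverse [MeasurableSpace M] (g : Spacetime n M) (μ : Measure M) (p : M) :
    g.reverse.volRatio μ p = (g.volRatio μ p)⁻¹ := by
  rw [volRatio, volRatio, inv_div, ← volFuture_eq_volPast_reverse,
    volFuture_eq_volPast_reverse g.reverse, reverse_reverse]

variable [T2Space M] {F : Set ℝ} {γ : ℝ → M}

lemma IsGloballyHyperbolic.exists_notMem_causalPast (hg : g.IsGloballyHyperbolic)
    (hγ : g.IsCausalCurve F γ) (hend : ∀ p, ¬ IsFutureEndpoint F γ p) (y : M) :
    ∃ t ∈ F, γ t ∉ g.causalPast {y} univ := by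
  by_contra! hy
  -- The curve is eventually in a compact set `J⁺(γ t₀) ∩ J⁻(y)`; by causality it has only one
  -- cluster point there, which is then a future endpoint.
  obtain ⟨t₀, ht₀⟩ := hγ.2.1.nonempty
  have : Nonempty F := ⟨⟨t₀, ht₀⟩⟩
  set u : F → M := fun t ↦ γ t
  have hmono : ∀ s t : F, s ≤ t → u t ∈ g.causalFuture {u s} univ := fun s t hst ↦
    hγ.mem_causalFuture s.2 t.2 hst
  have hK : IsCompact (g.causalFuture {γ t₀} univ ∩ g.causalPast {y} univ) := hg.2 _ _
  have hmem : ∀ᶠ t in atTop, u t ∈ g.causalFuture {γ t₀} univ ∩ g.causalPast {y} univ := by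
    filter_upwards [eventually_ge_atTop (⟨t₀, ht₀⟩ : F)] with t ht
    exact ⟨hmono _ t ht, hy t t.2⟩
  obtain ⟨x, -, hx⟩ := hK.exists_mapClusterPt_of_frequently hmem.frequently
  have hfuture : ∀ z, MapClusterPt z atTop u → ∀ t, z ∈ g.causalFuture {u t} univ := fun z hz t ↦
    (hg.isClosed_causalFuture (u t)).mem_of_mapClusterPt hz
      ((eventually_ge_atTop t).mono fun s hs ↦ hmono t s hs)
  have hrel : ∀ z, MapClusterPt z atTop u → ∀ w, MapClusterPt w atTop u →
      w ∈ g.causalFuture {z} univ := fun z hz w hw ↦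
    mem_causalPast.1 ((hg.isClosed_causalPast w).mem_of_mapClusterPt hz
      (.of_forall fun t ↦ mem_causalPast.2 (hfuture w hw t)))
  have htendsto : Tendsto u atTop (𝓝 x) := hK.tendsto_nhds_of_unique_mapClusterPt hmem
    fun z _ hz ↦ hg.eq_of_mem_causalFuture (hrel z hz x hx) (hrel x hx z hz)
  refine hend x fun V hV ↦ ?_
  obtain ⟨t, ht⟩ := eventually_atTop.1 (htendsto.eventually hV)
  exact ⟨t, t.2, fun s hs hts ↦ ht ⟨s, hs⟩ hts⟩

variable [MeasurableSpace M] [BorelSpace M] {μ : Measure M}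

lemma IsNormalizedVolume.tendsto_volFuture_atTop (hμ : IsNormalizedVolume n μ)
    (hg : g.IsGloballyHyperbolic) (hγ : g.IsCausalCurve F γ)
    (hend : ∀ p, ¬ IsFutureEndpoint F γ p) :
    Tendsto (fun t : F ↦ g.volFuture μ (γ t)) atTop (𝓝 0) := by
  have := hμ.isProbabilityMeasure
  have := hγ.1
  obtain ⟨t₀, ht₀⟩ := hγ.2.1.nonempty
  have : Nonempty F := ⟨⟨t₀, ht₀⟩⟩
  have hlim := tendsto_measure_iInter_atTop (μ := μ) (s := fun t : F ↦ g.chronFuture {γ t} univ)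
    (fun t ↦ (isOpen_chronFuture _).measurableSet.nullMeasurableSet)
    (fun s t hst x hx ↦ mem_chronFuture_of_causal_of_chron
      (hγ.mem_causalFuture s.2 t.2 hst) hx) ⟨⟨t₀, ht₀⟩, measure_ne_top _ _⟩
  have hempty : ⋂ t : F, g.chronFuture {γ t} univ = ∅ := by
    refine eq_empty_of_forall_notMem fun y hy ↦ ?_
    obtain ⟨t, ht, hty⟩ := hg.exists_notMem_causalPast hγ hend y
    exact hty (mem_causalPast.2 (mem_causalFuture_of_mem_chronFuture (mem_iInter.1 hy ⟨t, ht⟩)))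
  rw [hempty, measure_empty] at hlim
  exact (ENNReal.tendsto_toReal ENNReal.zero_ne_top).comp hlim

lemma volPast_le_volPast (hμ : IsNormalizedVolume n μ) (hg : g.IsGloballyHyperbolic) {p q : M}
    (h : q ∈ g.causalFuture {p} univ) : g.volPast μ p ≤ g.volPast μ q := by
  rcases eq_or_ne p q with rfl | hne
  · exact le_rfl
  · exact (volPast_lt_volPast hμ hg h hne).le

lemma IsNormalizedVolume.exists_lt_volRatio (hμ : IsNormalizedVolume n μ)
    (hg : g.IsGloballyHyperbolic) (hγ : g.IsCausalCurve F γ)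
    (hend : ∀ p, ¬ IsFutureEndpoint F γ p) (c : ℝ) : ∃ t ∈ F, c < g.volRatio μ (γ t) := by
  obtain ⟨t₀, ht₀⟩ := hγ.2.1.nonempty
  have : Nonempty F := ⟨⟨t₀, ht₀⟩⟩
  have hzero : Tendsto (fun t : F ↦ c * g.volFuture μ (γ t)) atTop (𝓝 0) := by
    simpa using (hμ.tendsto_volFuture_atTop hg hγ hend).const_mul c
  obtain ⟨t, ht, ht₀t⟩ := ((hzero.eventually_lt_const (volPast_pos hμ g (γ t₀))).and
    (eventually_ge_atTop (⟨t₀, ht₀⟩ : F))).exists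
  refine ⟨t, t.2, (lt_div_iff₀ (volFuture_pos hμ g _)).2 (ht.trans_le ?_)⟩
  exact volPast_le_volPast hμ hg (hγ.mem_causalFuture ht₀ t.2 ht₀t)

lemma IsNormalizedVolume.exists_volRatio_lt (hμ : IsNormalizedVolume n μ)
    (hg : g.IsGloballyHyperbolic) (hγ : g.IsCausalCurve F γ)
    (hend : ∀ p, ¬ IsPastEndpoint F γ p) {c : ℝ} (hc : 0 < c) :
    ∃ t ∈ F, g.volRatio μ (γ t) < c := by
  obtain ⟨t, ht, hlt⟩ := hμ.exists_lt_volRatio hg.reverse hγ.reverse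
    (fun p hp ↦ hend p (IsFutureEndpoint.isPastEndpoint_of_neg hp)) c⁻¹
  rw [volRatio_reverse] at hlt
  exact ⟨-t, ht, (inv_lt_inv₀ hc (div_pos (volPast_pos hμ g _) (volFuture_pos hμ g _))).1 hlt⟩

variable [SecondCountableTopology M]

lemma IsNormalizedVolume.isCauchySurface (hμ : IsNormalizedVolume n μ)
    (hg : g.IsGloballyHyperbolic) {c : ℝ} (hc : 0 < c) :
    g.IsCauchySurface {p | g.volRatio μ p = c} := by
  have hf := hμ.isTimeFunction hg
  refine ⟨isClosed_eq hf.continuous continuous_const, hf.isLipschitzHypersurface c,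
    fun p hp q hq hpq ↦ (hf.eq_of_apply_eq hpq (Eq.trans hp (Eq.symm hq))).symm, ?_⟩
  rintro F γ ⟨hγ, hfuture, hpast⟩
  obtain ⟨a, ha, hac⟩ := hμ.exists_volRatio_lt hg hγ hpast hc
  obtain ⟨b, hb, hcb⟩ := hμ.exists_lt_volRatio hg hγ hfuture c
  have hmono := hf.strictMonoOn hγ
  have hab : a < b := (hmono.lt_iff_lt ha hb).1 (hac.trans hcb)
  have hsub := hγ.1.out ha hb
  obtain ⟨t, ht, htc⟩ := intermediate_value_Icc hab.le
    (hf.continuous.comp_continuousOn (hγ.2.2.1.mono hsub)) ⟨hac.le, hcb.le⟩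
  exact ⟨t, ⟨hsub ht, htc⟩, fun s hs ↦ hmono.injOn hs.1 (hsub ht) (Eq.trans hs.2 htc.symm)⟩

end Spacetime

end CauchySurface

end Causality

end

theorem mainTheorem11 (n : ℕ) (hn : 1 ≤ n) (M : Type*) [TopologicalSpace M] [T2Space M]
    [ConnectedSpace M] [ChartedSpace (EuclideanSpace ℝ (Fin (n + 1))) M]
    [IsManifold (𝓡 (n + 1)) ∞ M] [MeasurableSpace M] [BorelSpace M]
    (g : Causality.Spacetime n M) (hg : g.IsGloballyHyperbolic) :
    -- causal futures and pasts of points are closed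
    (∀ p : M, IsClosed (g.causalFuture {p} univ) ∧ IsClosed (g.causalPast {p} univ)) ∧
    -- strong causality, and compactness of the spaces of non-spacelike curves
    ((∀ p : M, g.StronglyCausalAt p) ∧
      (univ : Set M) = g.causalPast univ univ ∩ g.causalFuture univ univ ∧
      ∀ p q : M, CompactSpace (g.CurveSpace p q)) ∧
    -- there are Cauchy surfaces
    (∃ S : Set M, g.IsCauchySurface S) ∧
    -- they are obtained as the level sets of the volume ratio, which is a time function
    (∃ μ : Measure M, Causality.Spacetime.IsNormalizedVolume n μ) ∧
    ∀ μ : Measure M, Causality.Spacetime.IsNormalizedVolume n μ →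
      (∀ p : M, 0 < g.volPast μ p ∧ 0 < g.volFuture μ p) ∧
      Continuous (g.volPast μ) ∧ Continuous (g.volFuture μ) ∧ Continuous (g.volRatio μ) ∧
      (∀ (F : Set ℝ) (γ : ℝ → M), g.IsCausalCurve F γ → StrictMonoOn (g.volRatio μ ∘ γ) F) ∧
      ∀ c : ℝ, 0 < c → g.IsCauchySurface {p | g.volRatio μ p = c} := by
  have := g.secondCountableTopology
  obtain ⟨μ, hμ⟩ := Causality.Spacetime.exists_isNormalizedVolume (n := n) (M := M)
  refine ⟨fun p ↦ ⟨hg.isClosed_causalFuture p, hg.isClosed_causalPast p⟩,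
    ⟨hg.1, ?_, (hμ.isTimeFunction hg).compactSpace_curveSpace hg⟩,
    ⟨_, hμ.isCauchySurface hg one_pos⟩, ⟨μ, hμ⟩, fun μ hμ ↦ ?_⟩
  · ext x
    exact iff_of_true (mem_univ x) ⟨Or.inl ⟨mem_univ x, mem_univ x⟩,
      Or.inl ⟨mem_univ x, mem_univ x⟩⟩
  · have hf := hμ.isTimeFunction hg
    exact ⟨fun p ↦ ⟨Causality.Spacetime.volPast_pos hμ g p,
      Causality.Spacetime.volFuture_pos hμ g p⟩, Causality.Spacetime.continuous_volPast hμ hg,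
      Causality.Spacetime.continuous_volFuture hμ hg, hf.continuous,
      fun F γ hγ ↦ hf.strictMonoOn hγ, fun c hc ↦ hμ.isCauchySurface hg hc⟩
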